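/- **Setting.** Let $b\ge 0$ and $d\in\mathbb N$. For $u=(\rho,\mathbf m,E)\in\mathbb R\times\mathbb R^d\times\mathbb R$ put $\mathbf v(u)=\mathbf m/\rho$, $e(u)=E/\rho-\tfrac12\|\mathbf v(u)\|^2$, and $$\mathcal B(b)=\{u:\ \rho>0,\ 1-b\rho>0,\ e(u)>0\}.$$ Let the pressure be any function $p:\mathcal B(b)\to[0,\infty)$, let $f(u)=(\mathbf m,\ \mathbf v\otimes\mathbf m+pI_d,\ \mathbf v(E+p))$ be the Euler flux, and put $$\gamma(u)=1+\frac{p(u)(1-b\rho)}{\rho e(u)},\qquad S(u,\gamma)=\rho e(u)\,\rho^{-\gamma}(1-b\rho)^{\gamma-1}.$$ Let $\mathcal V$ be an index set with finite stencils $\mathcal I(k)\ni k$, masses $m_k>0$ and vectors $\mathbf c_{kl}\in\mathbb R^d$ such that $\mathbf c_{kl}=0$ for $l\notin\mathcal I(k)$, $\mathbf c_{kl}=-\mathbf c_{lk}$ and $\sum_{l\in\mathcal I(k)}\mathbf c_{kl}=0$. Fix $i\in\mathcal V$ and states $U_j$ with $U_j\in\mathcal B(b)$ for all $j\in\mathcal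 I(i)$. For $\mathbf c_{kl}\ne0$ put $\mathbf n_{kl}=\mathbf c_{kl}/\|\mathbf c_{kl}\|$. **Extended Riemann problem.** This is the Riemann problem for $$\partial_t(\rho,m,\mathcal E,\Gamma)+\partial_x\Big(m,\ \tfrac{m^2}{\rho}+\mathsf p,\ \tfrac m\rho(\mathcal E+\mathsf p),\ \tfrac m\rho\Gamma\Big)=0,\qquad \mathsf p=\frac{\Gamma/\rho-1}{1-b\rho}\Big(\mathcal E-\frac{m^2}{2\rho}\Big).$$ The state $U=(\rho,\mathbf m,E)$ and the unit vector $\mathbf n$ give the datum $(\rho,\ \mathbf m\cdot\mathbf n,\ \mathcal E,\ \Gamma)$ with $\mathcal E=E-\frac{\|\mathbf m-(\mathbf m\cdot\mathbf n)\mathbf n\|^2}{2\rho}$ and $\Gamma=\rho\gamma(U)$. The problem for $(\mathbf n_{ij},U_i,U_j)$ has the datum of $U_i$ on the left and that of $U_j$ on the right (both with $\mathbf n=\mathbf n_{ij}$). A solution is a self-similar fan with values in $\{\rho>0,\ 1-b\rho>0,\ \mathcal E-\frac{m^2}{2\rho}>0,\ \Gamma/\rho\ge1\}$. It consists of a left acoustic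 wave, a contact discontinuity and a right acoustic wave, where each acoustic wave is absent, a Lax-admissible shock, or a centred rarefaction; alternatively it consists of two rarefactions separated by a vacuum. The maximum wave speed is the maximum of the absolute values of the speeds of the waves in the fan; the contact always counts, even when it has zero strength. For all $j\in\mathcal I(i)$ with $\mathbf c_{ij}\neq0$ let $\hat\lambda_{ij}$ and $\hat\lambda_{ji}$ be any positive numbers that are at least the maximum wave speeds of the problems for $(\mathbf n_{ij},U_i,U_j)$ and $(\mathbf n_{ji},U_j,U_i)$ respectively, and put $$d^L_{ij}=\max\big(\hat\lambda_{ij}\|\mathbf c_{ij}\|,\ \hat\lambda_{ji}\|\mathbf c_{ji}\|\big),\quad d^L_{ij}=0\ \text{ if }\ \mathbf c_{ij}=0.$$ If $j\in\mathcal I(i)$, $\mathbf c_{ij}\neq 0$ and one of $p(U_i),p(U_j)$ vanishes (the degenerate, pressureless case), assume that the Riemann problem for $(\mathbf n_{ij},U_i,U_j)$ has a solution. **Surrogate functional.** Put $$\overline U_{ij}=\tfrac12(U_i+U_j)-\frac1{2d^L_{ij}}\big(f(U_j)-f(U_i)\big)\mathbf c_{ij},$$ the last term being $0$ if $\mathbf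 c_{ij}=0$. Put $\gamma_i^{\min}=\min_{j\in\mathcal I(i)}\gamma(U_j)$, $$S_i^{\min}=\min\Big(\min_{j\in\mathcal I(i)}S(U_j,\gamma_i^{\min}),\ \min_{j\in\mathcal I(i)}S(\overline U_{ij},\gamma_i^{\min})\Big),$$ $$\Psi_i^s(u)=\rho e(u)-S_i^{\min}\rho^{\gamma_i^{\min}}(1-b\rho)^{1-\gamma_i^{\min}}.$$ **Theorem (surrogate entropy).** All the states $\overline U_{ij}$, $j\in\mathcal I(i)$, belong to $\mathcal B(b)$ (so that $\Psi^s_i$ is well defined), and: 1. $\Psi_i^s:\mathcal B(b)\to\mathbb R$ is concave. 2. Let $\tau>0$ and let $U_i^{L}$ be the low-order update, defined by $$\frac{m_i}{\tau}(U_i^{L}-U_i)+\sum_{j\in\mathcal I(i)}f(U_j)\mathbf c_{ij}-\sum_{j\in\mathcal I(i)\setminus\{i\}}d^L_{ij}(U_j-U_i)=0.$$ If $\tau\sum_{j\in\mathcal I(i)\setminus\{i\}}\frac{2d^L_{ij}}{m_i}\le1$, then $U_i^{L}\in\mathcal B(b)$ and $\Psi_i^s(U_i^{L})\ge0$. 3.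 Let $j\in\mathcal I(i)$ with $\mathbf c_{ij}\ne0$. If a solution of the Riemann problem for $(\mathbf n_{ij},U_i,U_j)$ has a shock wave, then $\Psi^s_i$ increases across it: $\Psi^s_i(u_a)<\Psi^s_i(u_b)$ whenever the density, normal momentum $\mathbf m\cdot\mathbf n_{ij}$ and normal energy $\mathcal E$ of $u_a$ and $u_b$ are those of the state ahead of the shock and of the state behind it, respectively. -/

import Mathlib

noncomputable section

namespace CovolumeEuler

/-! ### States of the Euler equations -/

/-- A state `u = (ρ, m, E)`: density, momentum (with its Euclidean norm), total energy. -/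
abbrev State (d : ℕ) : Type := ℝ × EuclideanSpace ℝ (Fin d) × ℝ

/-- The velocity `v(u) = m / ρ`. -/
def velocity {d : ℕ} (u : State d) : EuclideanSpace ℝ (Fin d) := u.1⁻¹ • u.2.1

/-- The specific internal energy `e(u) = E / ρ - ‖v(u)‖² / 2`. -/
def specificEnergy {d : ℕ} (u : State d) : ℝ := u.1⁻¹ * u.2.2 - (1 / 2) * ‖velocity u‖ ^ 2

/-- The admissible set `B(b)`. -/
def admissible (d : ℕ) (b : ℝ) : Set (State d) :=
  {u | 0 < u.1 ∧ 0 < 1 - b * u.1 ∧ 0 < specificEnergy u}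

/-- The product `f(u) c` of the Euler flux `f(u) = (m, v ⊗ m + p I, v (E + p))` and a vector `c`. -/
def flux {d : ℕ} (p : State d → ℝ) (u : State d) (c : EuclideanSpace ℝ (Fin d)) : State d :=
  (inner ℝ u.2.1 c,
   inner ℝ (velocity u) c • u.2.1 + p u • c,
   inner ℝ (velocity u) c * (u.2.2 + p u))

/-- `γ(u) = 1 + p (1 - b ρ) / (ρ e)`. -/
def gamma {d : ℕ} (b : ℝ) (p : State d → ℝ) (u : State d) : ℝ :=
  1 + p u * (1 - b * u.1) / (u.1 * specificEnergy u)

/-- `S(u, γ) = ρ e(u) ρ^(-γ) (1 - b ρ)^(γ - 1)`. -/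
def entropyS {d : ℕ} (b : ℝ) (u : State d) (γ : ℝ) : ℝ :=
  u.1 * specificEnergy u / u.1 ^ γ * (1 - b * u.1) ^ (γ - 1)

/-! ### The extended covolume Riemann problem -/

/-- A state `w = (ρ, m, 𝓔, Γ)` of the extended one-dimensional system. -/
abbrev ExtState : Type := ℝ × ℝ × ℝ × ℝ

namespace ExtState

/-- Velocity `m / ρ`. -/
def vel (w : ExtState) : ℝ := w.2.1 / w.1

/-- Internal energy per unit volume `𝓔 - m² / (2 ρ)`. -/
def intEnergy (w : ExtState) : ℝ := w.2.2.1 - w.2.1 ^ 2 / (2 * w.1)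

/-- `γ = Γ / ρ`. -/
def gam (w : ExtState) : ℝ := w.2.2.2 / w.1

/-- The covolume pressure. -/
def pcov (b : ℝ) (w : ExtState) : ℝ := (w.gam - 1) / (1 - b * w.1) * w.intEnergy

/-- The flux of the extended system. -/
def flux (b : ℝ) (w : ExtState) : ExtState :=
  (w.2.1,
   w.2.1 ^ 2 / w.1 + w.pcov b,
   w.2.1 / w.1 * (w.2.2.1 + w.pcov b),
   w.2.1 / w.1 * w.2.2.2)

/-- Non-vacuum states in the domain of the extended system. -/
def admissible (b : ℝ) : Set ExtState :=
  {w | 0 < w.1 ∧ 0 < 1 - b * w.1 ∧ 0 < w.intEnergy ∧ 1 ≤ w.gam}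

/-- The sound speed `a = √(γ p / (ρ (1 - b ρ)))`; the eigenvalues of the Jacobian of the flux are
`v - a`, `v` (twice) and `v + a`. -/
def soundSpeed (b : ℝ) (w : ExtState) : ℝ :=
  Real.sqrt (w.gam * w.pcov b / (w.1 * (1 - b * w.1)))

end ExtState

/-- The two genuinely nonlinear (acoustic) families, with eigenvalues `v - a` and `v + a`. -/
inductive Family
  | left
  | right

/-- The eigenvalue of the given acoustic family. -/
def Family.speed (b : ℝ) (w : ExtState) : Family → ℝ
  | .left => w.vel - w.soundSpeed b
  | .right => w.vel + w.soundSpeed b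

/-- The Rankine-Hugoniot condition for a jump from `w` to `w'` moving with speed `s`. -/
def RankineHugoniot (b : ℝ) (w w' : ExtState) (s : ℝ) : Prop :=
  ExtState.flux b w' - ExtState.flux b w = s • (w' - w)

/-- The Lax entropy inequalities for a shock of the given family, `w` being the state on the left
of the shock and `w'` the state on its right. -/
def LaxCondition (b : ℝ) (w w' : ExtState) (s : ℝ) : Family → Prop
  | .left => s < Family.left.speed b w ∧ Family.left.speed b w' < s ∧ s < w'.vel
  | .right => w.vel < s ∧ s < Family.right.speed b w ∧ Family.right.speed b w' < s

/-- A shock wave of speed `s` with left state `w` and right state `w'`. -/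
def IsShock (b : ℝ) (k : Family) (w w' : ExtState) (s : ℝ) : Prop :=
  w ∈ ExtState.admissible b ∧ w' ∈ ExtState.admissible b ∧
    RankineHugoniot b w w' s ∧ LaxCondition b w w' s k

/-- A contact discontinuity (possibly of zero strength) of speed `s`. -/
def IsContact (b : ℝ) (w w' : ExtState) (s : ℝ) : Prop :=
  w ∈ ExtState.admissible b ∧ w' ∈ ExtState.admissible b ∧
    w.vel = s ∧ w'.vel = s ∧ RankineHugoniot b w w' s

/-- A centred rarefaction wave `(x, t) ↦ R (x / t)`, `s ≤ x / t ≤ s'`, joining `w` to `w'`: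
a smooth self-similar solution of `∂ₜ w + ∂ₓ flux(w) = 0`, that is `flux(R)' = ξ R'`, along which
`ξ` is the eigenvalue of the given family. An end state may be the vacuum `0`. -/
def IsRarefaction (b : ℝ) (k : Family) (w w' : ExtState) (s s' : ℝ) (R : ℝ → ExtState) : Prop :=
  s < s' ∧ R s = w ∧ R s' = w' ∧ ContinuousOn R (Set.Icc s s') ∧
    ∀ ξ ∈ Set.Ioo s s', R ξ ∈ ExtState.admissible b ∧ k.speed b (R ξ) = ξ ∧
      ∃ R' : ExtState, HasDerivAt R R' ξ ∧
        HasDerivAt (fun x => ExtState.flux b (R x)) (ξ • R') ξ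

/-- An acoustic wave: absent, a shock, or a rarefaction. -/
inductive AcousticWave
  | absent
  | shock (s : ℝ)
  | rarefaction (s s' : ℝ) (R : ℝ → ExtState)

/-- The wave is a wave of the family `k` with left state `w` and right state `w'`. -/
def AcousticWave.Connects (b : ℝ) (k : Family) (w w' : ExtState) : AcousticWave → Prop
  | .absent => w = w'
  | .shock s => IsShock b k w w' s
  | .rarefaction s s' R => IsRarefaction b k w w' s s' R

/-- The speeds occurring in the wave. -/
def AcousticWave.speeds : AcousticWave → Set ℝ
  | .absent => ∅
  | .shock s => {s}
  | .rarefaction s s' _ => Set.Icc s s'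

/-- A self-similar fan: either a left acoustic wave, a contact of speed `v` between the states
`w₁` and `w₂`, and a right acoustic wave; or two rarefactions separated by a vacuum. -/
inductive RiemannFan
  | contact (W₁ : AcousticWave) (w₁ w₂ : ExtState) (v : ℝ) (W₃ : AcousticWave)
  | vacuum (s₁ s₁' : ℝ) (R₁ : ℝ → ExtState) (s₃ s₃' : ℝ) (R₃ : ℝ → ExtState)

/-- The fan is a solution of the extended Riemann problem with left data `wL` and right data
`wR`. -/
def RiemannFan.Solves (b : ℝ) (wL wR : ExtState) : RiemannFan → Prop
  | .contact W₁ w₁ w₂ v W₃ =>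
      W₁.Connects b .left wL w₁ ∧ IsContact b w₁ w₂ v ∧ W₃.Connects b .right w₂ wR
  | .vacuum s₁ s₁' R₁ s₃ s₃' R₃ =>
      IsRarefaction b .left wL 0 s₁ s₁' R₁ ∧ s₁' ≤ s₃ ∧
        IsRarefaction b .right 0 wR s₃ s₃' R₃

/-- The speeds of all the waves of the fan. -/
def RiemannFan.speeds : RiemannFan → Set ℝ
  | .contact W₁ _ _ v W₃ => W₁.speeds ∪ {v} ∪ W₃.speeds
  | .vacuum s₁ s₁' _ s₃ s₃' _ => Set.Icc s₁ s₁' ∪ Set.Icc s₃ s₃'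

/-- The fan (with data `wL`, `wR`) contains a shock wave; `wa` is the state ahead of (before) the
shock, and `wb` the state behind (after) it. -/
def RiemannFan.HasShock (wL wR wa wb : ExtState) : RiemannFan → Prop
  | .contact W₁ w₁ w₂ _ W₃ =>
      (∃ s, W₁ = .shock s ∧ wa = wL ∧ wb = w₁) ∨ (∃ s, W₃ = .shock s ∧ wa = wR ∧ wb = w₂)
  | .vacuum .. => False

/-- `lam` is a positive number larger than or equal to the maximum wave speed of the Riemann
problem. -/
def IsWaveSpeedBound (b : ℝ) (wL wR : ExtState) (lam : ℝ) : Prop :=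
  0 < lam ∧ ∀ F : RiemannFan, F.Solves b wL wR → ∀ s ∈ F.speeds, |s| ≤ lam

/-! ### From the Euler states to the extended Riemann problem -/

/-- The normal energy `𝓔 = E - ‖m - (m · n) n‖² / (2 ρ)`. -/
def normalEnergy {d : ℕ} (n : EuclideanSpace ℝ (Fin d)) (u : State d) : ℝ :=
  u.2.2 - ‖u.2.1 - (inner ℝ u.2.1 n : ℝ) • n‖ ^ 2 / (2 * u.1)

/-- The datum `(ρ, m · n, 𝓔, Γ)` of the extended Riemann problem given by the state `u`, with
`Γ = ρ + p (1 - b ρ) / e`. -/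
def riemannDatum {d : ℕ} (b : ℝ) (p : State d → ℝ) (n : EuclideanSpace ℝ (Fin d))
    (u : State d) : ExtState :=
  (u.1, inner ℝ u.2.1 n, normalEnergy n u, u.1 + p u * (1 - b * u.1) / specificEnergy u)

/-- The state `u` has the density, normal momentum and normal energy of the extended state `w`. -/
def Represents {d : ℕ} (n : EuclideanSpace ℝ (Fin d)) (u : State d) (w : ExtState) : Prop :=
  u.1 = w.1 ∧ inner ℝ u.2.1 n = w.2.1 ∧ normalEnergy n u = w.2.2.1

/-! ### The low-order scheme and the surrogate functional -/

/-- The unit vector `c / ‖c‖`. -/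
def direction {d : ℕ} (c : EuclideanSpace ℝ (Fin d)) : EuclideanSpace ℝ (Fin d) := ‖c‖⁻¹ • c

/-- The low-order graph viscosity. -/
def graphViscosity {V : Type*} {d : ℕ} (c : V → V → EuclideanSpace ℝ (Fin d)) (lam : V → V → ℝ)
    (i j : V) : ℝ :=
  max (lam i j * ‖c i j‖) (lam j i * ‖c j i‖)

/-- The auxiliary state `(U_i + U_j) / 2 - (f(U_j) - f(U_i)) c_ij / (2 d_ij)`. When `j = i` or
`c_ij = 0` the last term vanishes, whatever the value of `d_ij`. -/
def barState {V : Type*} {d : ℕ} (p : State d → ℝ) (c : V → V → EuclideanSpace ℝ (Fin d))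
    (dL : V → V → ℝ) (U : V → State d) (i j : V) : State d :=
  (1 / 2 : ℝ) • (U i + U j) -
    (1 / (2 * dL i j)) • (flux p (U j) (c i j) - flux p (U i) (c i j))

/-- `U⁺` is the low-order update at node `i` with time step `τ`. -/
def IsLowOrderUpdate {V : Type*} [DecidableEq V] {d : ℕ} (p : State d → ℝ)
    (c : V → V → EuclideanSpace ℝ (Fin d)) (dL : V → V → ℝ) (I : V → Finset V) (m : V → ℝ)
    (U : V → State d) (i : V) (τ : ℝ) (Uplus : State d) : Prop :=
  (m i / τ) • (Uplus - U i) + ∑ j ∈ I i, flux p (U j) (c i j)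
    - ∑ j ∈ (I i).erase i, dL i j • (U j - U i) = 0

/-- The minimum of `γ_j` over the stencil `s`. -/
def gammaMin {V : Type*} {d : ℕ} (b : ℝ) (p : State d → ℝ) (U : V → State d)
    (s : Finset V) (hs : s.Nonempty) : ℝ :=
  s.inf' hs fun j => gamma b p (U j)

/-- The minimum of `S(·, γmin)` over the states and the auxiliary states of the stencil `s` of
the node `i`. -/
def entropyMin {V : Type*} {d : ℕ} (b : ℝ) (p : State d → ℝ)
    (c : V → V → EuclideanSpace ℝ (Fin d)) (dL : V → V → ℝ) (U : V → State d) (i : V)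
    (s : Finset V) (hs : s.Nonempty) : ℝ :=
  min (s.inf' hs fun j => entropyS b (U j) (gammaMin b p U s hs))
    (s.inf' hs fun j => entropyS b (barState p c dL U i j) (gammaMin b p U s hs))

/-- The surrogate functional of the node `i` with stencil `s`. -/
def surrogate {V : Type*} {d : ℕ} (b : ℝ) (p : State d → ℝ)
    (c : V → V → EuclideanSpace ℝ (Fin d)) (dL : V → V → ℝ) (U : V → State d) (i : V)
    (s : Finset V) (hs : s.Nonempty) (u : State d) : ℝ :=
  u.1 * specificEnergy u -
    entropyMin b p c dL U i s hs * u.1 ^ gammaMin b p U s hs *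
      (1 - b * u.1) ^ (1 - gammaMin b p U s hs)

end CovolumeEuler

end

open CovolumeEuler

/-!
The auxiliary state `barState` of an edge is the average over `|x / t| ≤ λ` of the Riemann fan of
that edge, where `λ = d_ij / ‖c_ij‖` bounds the wave speeds. Averages are controlled by
duality: positivity of the internal energy is positivity of the linear functionals
`E - k m + k² ρ / 2` (the energy in frames moving with velocity `k`), so that the admissible set is
cut out by affine functionals. For such a functional `α + ℓ` the integral over the fan is read off
from the conservation law: `flux(w) - s w` does not jump across shocks and contacts, and it has
derivative `-w` along a rarefaction. This gives `RiemannFan.Solves.fanIntegral_pos`. At the edge of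
a vacuum the flux need not be continuous, but there `p² ≤ ρ² a² e` fixes its sign. The energy of
motion tangential to the edge is only advected and adds a nonnegative term
(`average_mem_admissible`).

A bound on the wave speeds says nothing unless the Riemann problem has a solution. When both
pressures are positive, `γ > 1` on both sides, and `exists_riemannFan_solves` constructs one: the
left and right wave curves are continuous in the pressure, and the intermediate value theorem makes
them meet, or else the rarefactions reach the vacuum.

Concavity of the surrogate functional is concavity of the internal energy together with convexity
of `ρ ^ γ (1 - b ρ) ^ (1 - γ)` for `γ ≥ 1`; the coefficient `entropyMin` is positive because all
auxiliary states are admissible. The low-order update is a convex combination of auxiliary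
states (`IsLowOrderUpdate.eq_sum`), and on each of these the surrogate functional is nonnegative by
the definition of `entropyMin`.

Finally, with the volume `τ = 1 / ρ - b` in place of `1 / ρ` the Hugoniot relation of the covolume
gas is that of an ideal gas. Hence Lax shocks are compressive (`IsShock.compressive`) and increase
the entropy of every exponent `β ≤ γ` (`IsShock.intEnergy_mul_lt`), in particular that of
`gammaMin`, which is what the surrogate functional measures.
-/

namespace CovolumeEuler

/-! ### Internal energy and the admissible set -/

theorem mul_specificEnergy {d : ℕ} {u : State d} (h : 0 < u.1) :
    u.1 * specificEnergy u = u.2.2 - ‖u.2.1‖ ^ 2 / (2 * u.1) := by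
  have : ‖velocity u‖ = u.1⁻¹ * ‖u.2.1‖ := by
    rw [velocity, norm_smul, Real.norm_of_nonneg (inv_nonneg.2 h.le)]
  rw [specificEnergy, this]
  field_simp

theorem mem_admissible_iff {d : ℕ} {b : ℝ} {u : State d} :
    u ∈ admissible d b ↔
      0 < u.1 ∧ 0 < 1 - b * u.1 ∧ 0 < u.2.2 - ‖u.2.1‖ ^ 2 / (2 * u.1) := by
  refine and_congr_right fun h => and_congr_right fun _ => ?_
  rw [← mul_specificEnergy h, mul_pos_iff_of_pos_left h]

/-- The linear functional `E - k · m + ‖k‖² ρ / 2`, the energy of `u` in a frame moving with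
velocity `k`. The internal energy is its minimum over `k`. -/
noncomputable def frameEnergy {d : ℕ} (k : EuclideanSpace ℝ (Fin d)) (u : State d) : ℝ :=
  u.2.2 - inner ℝ k u.2.1 + ‖k‖ ^ 2 / 2 * u.1

theorem frameEnergy_eq {d : ℕ} (k : EuclideanSpace ℝ (Fin d)) {u : State d} (h : 0 < u.1) :
    frameEnergy k u = u.2.2 - ‖u.2.1‖ ^ 2 / (2 * u.1) + u.1 / 2 * ‖k - velocity u‖ ^ 2 := by
  have h1 : ‖velocity u‖ = u.1⁻¹ * ‖u.2.1‖ := by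
    rw [velocity, norm_smul, Real.norm_of_nonneg (inv_nonneg.2 h.le)]
  rw [frameEnergy, @norm_sub_sq_real, h1, velocity, inner_smul_right]
  field_simp
  ring

theorem internalEnergy_le_frameEnergy {d : ℕ} (k : EuclideanSpace ℝ (Fin d)) {u : State d}
    (h : 0 < u.1) : u.2.2 - ‖u.2.1‖ ^ 2 / (2 * u.1) ≤ frameEnergy k u := by
  rw [frameEnergy_eq k h]
  have := h.le
  have : 0 ≤ u.1 / 2 * ‖k - velocity u‖ ^ 2 := by positivity
  linarith

theorem frameEnergy_velocity {d : ℕ} {u : State d} (h : 0 < u.1) :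
    frameEnergy (velocity u) u = u.2.2 - ‖u.2.1‖ ^ 2 / (2 * u.1) := by
  simp [frameEnergy_eq _ h]

theorem frameEnergy_add {d : ℕ} (k : EuclideanSpace ℝ (Fin d)) (u v : State d) :
    frameEnergy k (u + v) = frameEnergy k u + frameEnergy k v := by
  simp only [frameEnergy, Prod.fst_add, Prod.snd_add, inner_add_right]
  ring

theorem frameEnergy_smul {d : ℕ} (k : EuclideanSpace ℝ (Fin d)) (r : ℝ) (u : State d) :
    frameEnergy k (r • u) = r * frameEnergy k u := by
  simp only [frameEnergy, Prod.smul_fst, Prod.smul_snd, inner_smul_right, smul_eq_mul]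
  ring

/-- The internal energy is concave, being a minimum of linear functionals. -/
theorem concaveOn_internalEnergy {d : ℕ} :
    ConcaveOn ℝ {u : State d | 0 < u.1} fun u => u.2.2 - ‖u.2.1‖ ^ 2 / (2 * u.1) := by
  have hc : Convex ℝ {u : State d | 0 < u.1} :=
    (convex_Ioi (0 : ℝ)).linear_preimage (LinearMap.fst ℝ ℝ (EuclideanSpace ℝ (Fin d) × ℝ))
  refine ⟨hc, fun x hx y hy s t hs ht hst => ?_⟩
  have hz := hc hx hy hs ht hst
  rw [Set.mem_ofPred_eq] at hx hy hz
  beta_reduce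
  -- in the frame of the convex combination both sides are linear
  rw [← frameEnergy_velocity hz, frameEnergy_add, frameEnergy_smul, frameEnergy_smul]
  simp only [smul_eq_mul]
  gcongr
  · exact internalEnergy_le_frameEnergy _ hx
  · exact internalEnergy_le_frameEnergy _ hy

theorem convex_admissible (d : ℕ) (b : ℝ) : Convex ℝ (admissible d b) := by
  intro x hx y hy s t hs ht hst
  rw [mem_admissible_iff] at *
  have hc := concaveOn_internalEnergy (d := d)
  have h1 := hc.1 hx.1 hy.1 hs ht hst
  have h2 := hc.2 hx.1 hy.1 hs ht hst
  have pos : ∀ p q : ℝ, 0 < p → 0 < q → 0 < s * p + t * q := fun p q hp hq =>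
    (convex_Ioi (0 : ℝ)) hp hq hs ht hst
  refine ⟨h1, ?_, (pos _ _ hx.2.2 hy.2.2).trans_le h2⟩
  have := pos _ _ hx.2.1 hy.2.1
  simp only [Prod.fst_add, Prod.smul_fst, smul_eq_mul]
  linear_combination this + hst

/-! ### The isentropic energy and concavity of the surrogate functional -/

/-- The internal energy per unit volume `ρ^γ (1 - b ρ)^(1 - γ)` of a covolume gas of density `ρ`
and unit entropy `S`. -/
noncomputable def isentropicEnergy (b γ ρ : ℝ) : ℝ := ρ ^ γ * (1 - b * ρ) ^ (1 - γ)

theorem isentropicEnergy_pos {b γ ρ : ℝ} (h : 0 < ρ) (h' : 0 < 1 - b * ρ) :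
    0 < isentropicEnergy b γ ρ :=
  mul_pos (Real.rpow_pos_of_pos h _) (Real.rpow_pos_of_pos h' _)

theorem isentropicEnergy_eq {b γ ρ : ℝ} (h : 0 < ρ) (h' : 0 < 1 - b * ρ) :
    isentropicEnergy b γ ρ = (1 - b * ρ) * (ρ / (1 - b * ρ)) ^ γ := by
  rw [isentropicEnergy, Real.rpow_sub h', Real.rpow_one, Real.div_rpow h.le h'.le]
  ring

theorem convexOn_isentropicEnergy {b γ : ℝ} (hγ : 1 ≤ γ) :
    ConvexOn ℝ {ρ | 0 < ρ ∧ 0 < 1 - b * ρ} (isentropicEnergy b γ) := by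
  have pos : ∀ s t : ℝ, 0 ≤ s → 0 ≤ t → s + t = 1 → ∀ p q : ℝ, 0 < p → 0 < q →
      0 < s * p + t * q := fun s t hs ht hst p q hp hq =>
    (convex_Ioi (0 : ℝ)) hp hq hs ht hst
  have hc : Convex ℝ {ρ : ℝ | 0 < ρ ∧ 0 < 1 - b * ρ} := by
    intro x hx y hy s t hs ht hst
    refine ⟨pos s t hs ht hst _ _ hx.1 hy.1, ?_⟩
    have := pos s t hs ht hst _ _ hx.2 hy.2
    simp only [smul_eq_mul]
    linear_combination this + hst
  refine ⟨hc, fun x hx y hy s t hs ht hst => ?_⟩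
  have hz := hc hx hy hs ht hst
  rw [isentropicEnergy_eq hz.1 hz.2, isentropicEnergy_eq hx.1 hx.2, isentropicEnergy_eq hy.1 hy.2]
  have hX := hx.2
  have hY := hy.2
  have hx1 := hx.1
  have hy1 := hy.1
  have hZ := hz.2
  simp only [smul_eq_mul] at hZ ⊢
  set X := 1 - b * x with hXd
  set Y := 1 - b * y with hYd
  set Z := 1 - b * (s * x + t * y) with hZd
  have hXYZ : s * X + t * Y = Z := by rw [hXd, hYd, hZd]; linear_combination hst
  -- Jensen's inequality for `r ↦ r ^ γ` with the weights `s X / Z` and `t Y / Z`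
  have hwx : 0 ≤ s * X / Z := by positivity
  have hwy : 0 ≤ t * Y / Z := by positivity
  have h := (convexOn_rpow hγ).2 (Set.mem_Ici.2 (by positivity : 0 ≤ x / X))
    (Set.mem_Ici.2 (by positivity : 0 ≤ y / Y)) hwx hwy
    (by rw [← add_div, hXYZ, div_self hZ.ne'])
  simp only [smul_eq_mul] at h
  have e1 : s * X / Z * (x / X) + t * Y / Z * (y / Y) = (s * x + t * y) / Z := by field_simp
  rw [e1] at h
  calc _ ≤ Z * (s * X / Z * (x / X) ^ γ + t * Y / Z * (y / Y) ^ γ) := by gcongr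
    _ = _ := by field_simp

theorem isentropicEnergy_le {b γ ρ ρ' : ℝ} (hb : 0 ≤ b) (hγ : 1 ≤ γ) (h : 0 < ρ)
    (hρ : ρ ≤ ρ') (h' : 0 < 1 - b * ρ') :
    isentropicEnergy b γ ρ ≤ isentropicEnergy b γ ρ' := by
  have : 1 - b * ρ' ≤ 1 - b * ρ := by gcongr
  exact mul_le_mul (Real.rpow_le_rpow h.le hρ (by linarith))
    (Real.rpow_le_rpow_of_nonpos h' this (by linarith))
    (Real.rpow_nonneg (h'.le.trans this) _) (Real.rpow_nonneg (h.le.trans hρ) _)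

theorem entropyS_mul_isentropicEnergy {d : ℕ} {b : ℝ} {u : State d} (hu : u ∈ admissible d b)
    (γ : ℝ) : entropyS b u γ * isentropicEnergy b γ u.1 = u.1 * specificEnergy u := by
  have h1 := Real.rpow_pos_of_pos hu.1 γ
  have h2 := Real.rpow_pos_of_pos hu.2.1 (γ - 1)
  rw [entropyS, isentropicEnergy, show (1 - γ) = -(γ - 1) by ring, Real.rpow_neg hu.2.1.le,
    div_mul_eq_mul_div, div_mul_eq_mul_div, div_eq_iff h1.ne']
  linear_combination u.1 * specificEnergy u * u.1 ^ γ * mul_inv_cancel₀ h2.ne'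

theorem entropyS_pos {d : ℕ} {b : ℝ} {u : State d} (hu : u ∈ admissible d b) (γ : ℝ) :
    0 < entropyS b u γ := by
  have h1 := Real.rpow_pos_of_pos hu.1 γ
  have h2 := Real.rpow_pos_of_pos hu.2.1 (γ - 1)
  have h3 := mul_pos hu.1 hu.2.2
  unfold entropyS
  positivity

theorem concaveOn_mul_specificEnergy_sub {d : ℕ} {b γ S : ℝ} (hγ : 1 ≤ γ) (hS : 0 ≤ S) :
    ConcaveOn ℝ (admissible d b) fun u =>
      u.1 * specificEnergy u - S * isentropicEnergy b γ u.1 := by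
  have h1 : ConcaveOn ℝ (admissible d b) fun u : State d => u.1 * specificEnergy u :=
    (concaveOn_internalEnergy.subset (fun u hu => hu.1) (convex_admissible d b)).congr
      fun u hu => (mul_specificEnergy hu.1).symm
  have h2 : ConvexOn ℝ (admissible d b) fun u : State d => isentropicEnergy b γ u.1 :=
    ((convexOn_isentropicEnergy (b := b) hγ).comp_linearMap
      (LinearMap.fst ℝ ℝ (EuclideanSpace ℝ (Fin d) × ℝ))).subset
      (fun u hu => ⟨hu.1, hu.2.1⟩) (convex_admissible d b)
  exact h1.sub (h2.smul hS)

/-! ### Extended states in primitive variables -/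

theorem ExtState.gam_mul_fst {w : ExtState} (h : 0 < w.1) : w.2.2.2 = w.gam * w.1 := by
  rw [ExtState.gam]; field_simp

theorem ExtState.vel_mul_fst {w : ExtState} (h : 0 < w.1) : w.2.1 = w.vel * w.1 := by
  rw [ExtState.vel]; field_simp

theorem ExtState.energy_eq {w : ExtState} (h : 0 < w.1) :
    w.2.2.1 = w.intEnergy + w.1 * w.vel ^ 2 / 2 := by
  rw [ExtState.intEnergy, ExtState.vel]; field_simp; ring

theorem ExtState.pcov_mul {b : ℝ} {w : ExtState} (h : 0 < 1 - b * w.1) :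
    w.pcov b * (1 - b * w.1) = (w.gam - 1) * w.intEnergy := by
  rw [ExtState.pcov]; field_simp

theorem ExtState.pcov_nonneg {b : ℝ} {w : ExtState} (h : w ∈ ExtState.admissible b) :
    0 ≤ w.pcov b :=
  mul_nonneg (div_nonneg (sub_nonneg.2 h.2.2.2) h.2.1.le) h.2.2.1.le

theorem ExtState.soundSpeed_sq {b : ℝ} {w : ExtState} (h : w ∈ ExtState.admissible b) :
    w.soundSpeed b ^ 2 * (w.1 * (1 - b * w.1)) = w.gam * w.pcov b := by
  have h0 := ExtState.pcov_nonneg h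
  obtain ⟨h1, h2, h3, h4⟩ := h
  have h5 := mul_pos h1 h2
  rw [ExtState.soundSpeed, Real.sq_sqrt (div_nonneg (by nlinarith) h5.le),
    div_mul_cancel₀ _ h5.ne']

theorem ExtState.soundSpeed_nonneg (b : ℝ) (w : ExtState) : 0 ≤ w.soundSpeed b :=
  Real.sqrt_nonneg _

/-- The flux in primitive variables. -/
theorem ExtState.flux_eq {b : ℝ} {w : ExtState} (h : 0 < w.1) :
    ExtState.flux b w = (w.vel * w.1, w.vel ^ 2 * w.1 + w.pcov b,
      w.vel * (w.2.2.1 + w.pcov b), w.vel * w.gam * w.1) := by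
  rw [ExtState.flux, ExtState.vel, ExtState.gam]
  refine Prod.ext ?_ (Prod.ext ?_ (Prod.ext ?_ ?_)) <;> simp only <;> field_simp

/-- The Rankine-Hugoniot condition in primitive variables: the mass flux `ρ (v - s)` is the same
on both sides, and carries momentum, energy and `γ`. -/
theorem rankineHugoniot_iff {b s : ℝ} {w w' : ExtState} (h : 0 < w.1) (h' : 0 < w'.1) :
    RankineHugoniot b w w' s ↔
      w'.1 * (w'.vel - s) = w.1 * (w.vel - s) ∧
      w.1 * (w.vel - s) * (w'.vel - w.vel) = w.pcov b - w'.pcov b ∧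
      w'.2.2.1 * (w'.vel - s) - w.2.2.1 * (w.vel - s)
        = w.vel * w.pcov b - w'.vel * w'.pcov b ∧
      w.1 * (w.vel - s) * (w'.gam - w.gam) = 0 := by
  have e : ∀ w : ExtState, 0 < w.1 → w = (w.1, w.vel * w.1, w.2.2.1, w.gam * w.1) := by
    intro w h
    rw [← ExtState.vel_mul_fst h, ← ExtState.gam_mul_fst h]
  have hd : w' - w = (w'.1 - w.1, w'.vel * w'.1 - w.vel * w.1, w'.2.2.1 - w.2.2.1,
      w'.gam * w'.1 - w.gam * w.1) := by
    rw [← ExtState.vel_mul_fst h, ← ExtState.gam_mul_fst h, ← ExtState.vel_mul_fst h',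
      ← ExtState.gam_mul_fst h']
    rfl
  rw [RankineHugoniot, ExtState.flux_eq h, ExtState.flux_eq h', hd]
  simp only [Prod.ext_iff, Prod.fst_sub, Prod.snd_sub, Prod.smul_fst, Prod.smul_snd, smul_eq_mul]
  constructor
  · rintro ⟨h1, h2, h3, h4⟩
    refine ⟨by linear_combination h1, by linear_combination h2 - w'.vel * h1,
      by linear_combination h3, by linear_combination h4 - w'.gam * h1⟩
  · rintro ⟨h1, h2, h3, h4⟩
    refine ⟨by linear_combination h1, by linear_combination h2 + w'.vel * h1,
      by linear_combination h3, by linear_combination h4 + w'.gam * h1⟩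

/-! ### Reflection of the axis -/

/-- The state seen after the reflection `x ↦ -x`. -/
def ExtState.reflect (w : ExtState) : ExtState := (w.1, -w.2.1, w.2.2.1, w.2.2.2)

@[simp] theorem ExtState.reflect_reflect (w : ExtState) : w.reflect.reflect = w := by
  simp [ExtState.reflect]

@[simp] theorem ExtState.reflect_fst (w : ExtState) : w.reflect.1 = w.1 := rfl

@[simp] theorem ExtState.reflect_intEnergy (w : ExtState) : w.reflect.intEnergy = w.intEnergy := by
  simp [ExtState.reflect, ExtState.intEnergy]

@[simp] theorem ExtState.reflect_gam (w : ExtState) : w.reflect.gam = w.gam := rfl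

@[simp] theorem ExtState.reflect_vel (w : ExtState) : w.reflect.vel = -w.vel := by
  simp [ExtState.reflect, ExtState.vel, neg_div]

@[simp] theorem ExtState.reflect_pcov (b : ℝ) (w : ExtState) : w.reflect.pcov b = w.pcov b := by
  simp [ExtState.pcov]

@[simp] theorem ExtState.reflect_soundSpeed (b : ℝ) (w : ExtState) :
    w.reflect.soundSpeed b = w.soundSpeed b := by
  simp [ExtState.soundSpeed]

@[simp] theorem ExtState.reflect_mem_admissible {b : ℝ} {w : ExtState} :
    w.reflect ∈ ExtState.admissible b ↔ w ∈ ExtState.admissible b := by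
  simp [ExtState.admissible]

theorem ExtState.flux_reflect (b : ℝ) (w : ExtState) :
    ExtState.flux b w.reflect = -(ExtState.flux b w).reflect := by
  simp [ExtState.flux, ExtState.reflect, ← ExtState.reflect_pcov b w, neg_div]

theorem IsShock.reflect_right {b : ℝ} {w w' : ExtState} {s : ℝ} (h : IsShock b .right w w' s) :
    IsShock b .left w'.reflect w.reflect (-s) := by
  obtain ⟨hw, hw', hRH, hl1, hl2, hl3⟩ := h
  refine ⟨by simpa, by simpa, ?_, ?_⟩
  · rw [RankineHugoniot, ExtState.flux_reflect, ExtState.flux_reflect]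
    simp only [RankineHugoniot, Prod.ext_iff, Prod.fst_sub, Prod.snd_sub, Prod.smul_fst,
      Prod.smul_snd, smul_eq_mul, ExtState.reflect, Prod.fst_neg, Prod.snd_neg] at hRH ⊢
    obtain ⟨h1, h2, h3, h4⟩ := hRH
    exact ⟨by linear_combination h1, by linear_combination -h2, by linear_combination h3,
      by linear_combination h4⟩
  · simp only [LaxCondition, Family.speed, ExtState.reflect_vel,
      ExtState.reflect_soundSpeed] at *
    exact ⟨by linarith, by linarith, by linarith⟩

theorem IsShock.reflect_left {b : ℝ} {w w' : ExtState} {s : ℝ} (h : IsShock b .left w w' s) :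
    IsShock b .right w'.reflect w.reflect (-s) := by
  obtain ⟨hw, hw', hRH, hl1, hl2, hl3⟩ := h
  refine ⟨by simpa, by simpa, ?_, ?_⟩
  · rw [RankineHugoniot, ExtState.flux_reflect, ExtState.flux_reflect]
    simp only [RankineHugoniot, Prod.ext_iff, Prod.fst_sub, Prod.snd_sub, Prod.smul_fst,
      Prod.smul_snd, smul_eq_mul, ExtState.reflect, Prod.fst_neg, Prod.snd_neg] at hRH ⊢
    obtain ⟨h1, h2, h3, h4⟩ := hRH
    exact ⟨by linear_combination h1, by linear_combination -h2, by linear_combination h3,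
      by linear_combination h4⟩
  · simp only [LaxCondition, Family.speed, ExtState.reflect_vel,
      ExtState.reflect_soundSpeed] at *
    exact ⟨by linarith, by linarith, by linarith⟩

/-! ### Entropy increases across a shock -/

/-- The pressure ratio `((γ + 1) x - (γ - 1)) / ((γ + 1) - (γ - 1) x)` of a shock of an ideal gas
with compression ratio `x > 1` exceeds the ratio `x ^ γ` of an isentropic compression. -/
theorem rpow_mul_lt_of_one_lt {γ x : ℝ} (hγ : 1 < γ) (hx : 1 < x)
    (hD : 0 < (γ + 1) - (γ - 1) * x) :
    x ^ γ * ((γ + 1) - (γ - 1) * x) < (γ + 1) * x - (γ - 1) := by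
  let F : ℝ → ℝ := fun y =>
    Real.log ((γ + 1) * y - (γ - 1)) - Real.log ((γ + 1) - (γ - 1) * y) - γ * Real.log y
  have pos : ∀ y ∈ Set.Icc 1 x,
      0 < y ∧ 0 < (γ + 1) * y - (γ - 1) ∧ 0 < (γ + 1) - (γ - 1) * y := by
    intro y hy
    have := hy.1
    have := hy.2
    exact ⟨by linarith, by nlinarith, by nlinarith⟩
  have hder : ∀ y ∈ Set.Icc 1 x, HasDerivAt F
      ((γ + 1) / ((γ + 1) * y - (γ - 1)) - -(γ - 1) / ((γ + 1) - (γ - 1) * y) - γ * y⁻¹) y := by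
    intro y hy
    obtain ⟨h1, h2, h3⟩ := pos y hy
    have d1 : HasDerivAt (fun y : ℝ => (γ + 1) * y - (γ - 1)) (γ + 1) y := by
      simpa using ((hasDerivAt_id y).const_mul (γ + 1)).sub_const (γ - 1)
    have d2 : HasDerivAt (fun y : ℝ => (γ + 1) - (γ - 1) * y) (-(γ - 1)) y := by
      simpa using ((hasDerivAt_id y).const_mul (γ - 1)).const_sub (γ + 1)
    exact ((d1.log h2.ne').sub (d2.log h3.ne')).sub ((Real.hasDerivAt_log h1.ne').const_mul γ)
  have hmono : StrictMonoOn F (Set.Icc 1 x) := by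
    refine strictMonoOn_of_deriv_pos (convex_Icc 1 x)
      (fun y hy => (hder y hy).continuousAt.continuousWithinAt) fun y hy => ?_
    rw [interior_Icc] at hy
    have hy' := Set.Ioo_subset_Icc_self hy
    obtain ⟨h1, h2, h3⟩ := pos y hy'
    rw [(hder y hy').deriv]
    have e : (γ + 1) / ((γ + 1) * y - (γ - 1)) - -(γ - 1) / ((γ + 1) - (γ - 1) * y) - γ * y⁻¹
        = γ * (γ ^ 2 - 1) * (y - 1) ^ 2 /
          (((γ + 1) * y - (γ - 1)) * ((γ + 1) - (γ - 1) * y) * y) := by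
      have h2' := h2.ne'
      have h3' := h3.ne'
      rw [div_sub_div _ _ h2' h3', ← div_eq_mul_inv, div_sub_div _ _ (mul_ne_zero h2' h3') h1.ne']
      congr 1
      ring
    rw [e]
    have h4 : 0 < y - 1 := sub_pos.2 hy.1
    have h5 : 0 < γ ^ 2 - 1 := by nlinarith
    positivity
  have hlt : F 1 < F x := hmono (Set.left_mem_Icc.2 hx.le) (Set.right_mem_Icc.2 hx.le) hx
  obtain ⟨h1, h2, h3⟩ := pos x (Set.right_mem_Icc.2 hx.le)
  have hF1 : F 1 = 0 := by simp [F]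
  rw [hF1] at hlt
  have hp : 0 < x ^ γ := Real.rpow_pos_of_pos h1 _
  rw [← Real.log_lt_log_iff (by positivity) h2, Real.log_mul hp.ne' hD.ne', Real.log_rpow h1]
  simp only [F] at hlt
  linarith

/-- A left shock is compressive. In terms of the volume `τ = 1 / ρ - b` the covolume Hugoniot
relation is that of an ideal gas, and with it the Lax inequalities leave only `τ' < τ`. -/
theorem IsShock.compressive {b : ℝ} {w w' : ExtState} {s : ℝ}
    (h : IsShock b .left w w' s) :
    w'.gam = w.gam ∧ 1 < w.gam ∧ w.1 < w'.1 ∧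
      w'.pcov b * ((1 - b * w'.1) / w'.1) - w.pcov b * ((1 - b * w.1) / w.1) =
        (w.gam - 1) * ((w.pcov b + w'.pcov b) / 2 *
          ((1 - b * w.1) / w.1 - (1 - b * w'.1) / w'.1)) := by
  obtain ⟨hw, hw', hRH, hl1, hl2, hl3⟩ := h
  have ha := ExtState.soundSpeed_sq hw
  have ha' := ExtState.soundSpeed_sq hw'
  have ha0 := ExtState.soundSpeed_nonneg b w
  have ha0' := ExtState.soundSpeed_nonneg b w'
  have hp0 := ExtState.pcov_nonneg hw
  have hp0' := ExtState.pcov_nonneg hw'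
  obtain ⟨hρ, hc, he, hg⟩ := hw
  obtain ⟨hρ', hc', he', hg'⟩ := hw'
  have hp := ExtState.pcov_mul hc
  have hp' := ExtState.pcov_mul hc'
  rw [rankineHugoniot_iff hρ hρ'] at hRH
  rw [ExtState.energy_eq hρ, ExtState.energy_eq hρ'] at hRH
  simp only [Family.speed] at hl1 hl2
  generalize w.gam = γ at *
  generalize w'.gam = γ' at *
  generalize w.vel = v at *
  generalize w'.vel = v' at *
  generalize w.pcov b = p at *
  generalize w'.pcov b = p' at *
  generalize w.soundSpeed b = a at *
  generalize w'.soundSpeed b = a' at *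
  generalize w.intEnergy = e at *
  generalize w'.intEnergy = e' at *
  generalize w.1 = ρ at *
  generalize w'.1 = ρ' at *
  obtain ⟨h1, h2, h3, h4⟩ := hRH
  have hvs : 0 < v - s := by linarith
  set j := ρ * (v - s) with hj
  have hj0 : 0 < j := mul_pos hρ hvs
  have hγ : γ' = γ := by
    rcases mul_eq_zero.1 h4 with h | h
    · exact absurd h hj0.ne'
    · linarith
  subst hγ
  have hv : v = s + j / ρ := by rw [hj]; field_simp; ring
  have hv' : v' = s + j / ρ' := by rw [← h1]; field_simp; ring
  -- for `γ = 1` the gas is pressureless and the Lax inequalities contradict each other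
  have hγ1 : 1 < γ' := by
    rcases hg.lt_or_eq with h | h
    · exact h
    · subst h
      have : p' = 0 := by
        have : p' * (1 - b * ρ') = 0 := by linarith
        exact (mul_eq_zero.1 this).resolve_right hc'.ne'
      rw [this, mul_zero] at ha'
      have : a' ^ 2 = 0 := (mul_eq_zero.1 ha').resolve_right (mul_pos hρ' hc').ne'
      have := pow_eq_zero_iff (two_ne_zero) |>.1 this
      linarith
  set τ := (1 - b * ρ) / ρ with hτ
  set τ' := (1 - b * ρ') / ρ' with hτ'
  have hτ0 : 0 < τ := by positivity
  have hτ0' : 0 < τ' := by positivity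
  have hinv : 1 / ρ = τ + b := by rw [hτ]; field_simp; ring
  have hinv' : 1 / ρ' = τ' + b := by rw [hτ']; field_simp; ring
  -- the Rayleigh line and the Hugoniot relation, with `τ = 1 / ρ - b`
  have hmom : j ^ 2 * (τ - τ') = p' - p := by
    have : v' - v = j * (τ' - τ) := by
      rw [hv, hv']
      linear_combination j * hinv' - j * hinv
    rw [this] at h2
    linear_combination -h2
  have hee : e = p * τ * ρ / (γ' - 1) := by
    rw [hτ, eq_div_iff (by linarith)]; field_simp; linarith
  have hee' : e' = p' * τ' * ρ' / (γ' - 1) := by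
    rw [hτ', eq_div_iff (by linarith)]; field_simp; linarith
  have hg1 : γ' - 1 ≠ 0 := by linarith
  have hug : p' * τ' - p * τ = (γ' - 1) * ((p + p') / 2 * (τ - τ')) := by
    have h3' : j * ((p' * τ' - p * τ) / (γ' - 1) + (v' ^ 2 - v ^ 2) / 2) = v * p - v' * p' := by
      rw [← h3, hee, hee', hv, hv']
      field_simp
      ring
    have hvv : v' ^ 2 - v ^ 2 = (v + v') * (j * (τ' - τ)) := by
      rw [show v' ^ 2 - v ^ 2 = (v + v') * (v' - v) by ring]
      congr 1
      rw [hv, hv']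
      linear_combination j * hinv' - j * hinv
    have hp'' : p' = p + j ^ 2 * (τ - τ') := by linarith
    have hvd : v' - v = j * (τ' - τ) := by
      rw [hv, hv']
      linear_combination j * hinv' - j * hinv
    have hvd' : v' = v + j * (τ' - τ) := by linarith
    have : j * ((p' * τ' - p * τ) / (γ' - 1)) = j * ((p + p') / 2 * (τ - τ')) := by
      have h5 := h3'
      rw [mul_add, hvv] at h5
      have h6 : j * ((v + v') * (j * (τ' - τ)) / 2) = (v + v') / 2 * (p - p') := by
        rw [hp'']; ring
      rw [h6] at h5
      rw [eq_sub_of_add_eq h5]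
      rw [hvd']
      ring
    have := mul_left_cancel₀ hj0.ne' this
    rw [div_eq_iff hg1] at this
    linarith
  refine ⟨rfl, hγ1, ?_, hug⟩
  -- the Lax inequalities give `γ p / τ < j² < γ p' / τ'`
  have hm : j ^ 2 * τ > γ' * p := by
    have : a ^ 2 < (v - s) ^ 2 := by
      apply pow_lt_pow_left₀ _ ha0 two_ne_zero; linarith
    have h7 : j ^ 2 * τ = (v - s) ^ 2 * (ρ * (1 - b * ρ)) := by
      rw [hj, hτ]; field_simp
    rw [h7, ← ha]
    exact mul_lt_mul_of_pos_right this (mul_pos hρ hc)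
  have hm' : j ^ 2 * τ' < γ' * p' := by
    have hvs' : 0 < v' - s := by linarith
    have : (v' - s) ^ 2 < a' ^ 2 := by
      apply pow_lt_pow_left₀ _ hvs'.le two_ne_zero; linarith
    have h7 : j ^ 2 * τ' = (v' - s) ^ 2 * (ρ' * (1 - b * ρ')) := by
      rw [← h1, hτ']; field_simp
    rw [h7, ← ha']
    exact mul_lt_mul_of_pos_right this (mul_pos hρ' hc')
  have hττ : τ' < τ := by
    by_contra hcon
    push Not at hcon
    have h8 : j ^ 2 * τ ≤ j ^ 2 * τ' := mul_le_mul_of_nonneg_left hcon (sq_nonneg j)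
    have h9 : γ' * p' ≤ γ' * p := mul_le_mul_of_nonneg_left (by linarith) (by linarith)
    linarith
  have : 1 / ρ' < 1 / ρ := by rw [hinv, hinv']; linarith
  exact (one_div_lt_one_div hρ' hρ).1 this

/-- The entropy `S(·, β)` increases across a left shock, for every exponent `β` that is at most
the adiabatic exponent `γ` of the gas. -/
theorem IsShock.intEnergy_mul_lt {b : ℝ} {w w' : ExtState} {s β : ℝ}
    (h : IsShock b .left w w' s) (hβ : β ≤ w.gam) :
    w.intEnergy * isentropicEnergy b β w'.1 < w'.intEnergy * isentropicEnergy b β w.1 := by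
  obtain ⟨hγ', hγ, hlt, hug⟩ := h.compressive
  obtain ⟨hw, hw', -⟩ := h
  have hp0 := ExtState.pcov_nonneg hw'
  obtain ⟨hρ, hc, he, hg⟩ := hw
  obtain ⟨hρ', hc', he', hg'⟩ := hw'
  have hp := ExtState.pcov_mul hc
  have hp' := ExtState.pcov_mul hc'
  rw [isentropicEnergy_eq hρ hc, isentropicEnergy_eq hρ' hc']
  rw [hγ'] at hp'
  generalize w.gam = γ at *
  generalize w.pcov b = p at *
  generalize w'.pcov b = p' at *
  generalize w.intEnergy = e at *
  generalize w'.intEnergy = e' at *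
  generalize w.1 = ρ at *
  generalize w'.1 = ρ' at *
  have hpp : 0 < p := by
    have : 0 < p * (1 - b * ρ) := by rw [hp]; exact mul_pos (by linarith) he
    exact pos_of_mul_pos_left this hc.le
  have hpp' : 0 < p' := by
    have : 0 < p' * (1 - b * ρ') := by rw [hp']; exact mul_pos (by linarith) he'
    exact pos_of_mul_pos_left this hc'.le
  have hr : ρ / (1 - b * ρ) = ((1 - b * ρ) / ρ)⁻¹ := by rw [inv_div]
  have hr' : ρ' / (1 - b * ρ') = ((1 - b * ρ') / ρ')⁻¹ := by rw [inv_div]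
  have hττ : (1 - b * ρ') / ρ' < (1 - b * ρ) / ρ := by
    rw [div_lt_div_iff₀ hρ' hρ]; nlinarith
  rw [hr, hr', Real.inv_rpow (by positivity), Real.inv_rpow (by positivity)]
  set τ := (1 - b * ρ) / ρ with hτ
  set τ' := (1 - b * ρ') / ρ' with hτ'
  have hτ0 : 0 < τ := by positivity
  have hτ0' : 0 < τ' := by positivity
  set x := τ / τ' with hx
  have hx1 : 1 < x := (one_lt_div hτ0').2 hττ
  have hτx : τ = x * τ' := by rw [hx]; field_simp
  have hug' : p' * ((γ + 1) - (γ - 1) * x) = p * ((γ + 1) * x - (γ - 1)) := by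
    rw [hτx] at hug
    have : τ' * (p' * ((γ + 1) - (γ - 1) * x)) = τ' * (p * ((γ + 1) * x - (γ - 1))) := by
      linear_combination 2 * hug
    exact mul_left_cancel₀ hτ0'.ne' this
  have hN : 0 < (γ + 1) * x - (γ - 1) := by nlinarith
  have hD : 0 < (γ + 1) - (γ - 1) * x :=
    pos_of_mul_pos_right (by rw [hug']; positivity) hpp'.le
  have hS := rpow_mul_lt_of_one_lt hγ hx1 hD
  -- a smaller exponent weakens the claim because `x > 1`
  have hS' : p * x ^ β < p' := by
    have h1 : x ^ β ≤ x ^ γ := Real.rpow_le_rpow_of_exponent_le hx1.le hβ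
    have h2 : p * x ^ γ < p' := by
      refine lt_of_mul_lt_mul_right ?_ hD.le
      rw [hug', mul_assoc]
      exact mul_lt_mul_of_pos_left hS hpp
    exact (mul_le_mul_of_nonneg_left h1 hpp.le).trans_lt h2
  have hxβ : τ ^ β = x ^ β * τ' ^ β := by
    rw [hτx, Real.mul_rpow (by positivity) hτ0'.le]
  have hτβ : 0 < τ' ^ β := Real.rpow_pos_of_pos hτ0' _
  have hxβ0 : 0 < x ^ β := Real.rpow_pos_of_pos (by linarith) _
  have e1 : e = p * (1 - b * ρ) / (γ - 1) := by rw [hp]; field_simp [sub_ne_zero.2 hγ.ne']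
  have e2 : e' = p' * (1 - b * ρ') / (γ - 1) := by rw [hp']; field_simp [sub_ne_zero.2 hγ.ne']
  have hγ0 : 0 < γ - 1 := by linarith
  rw [hxβ, e1, e2]
  have l : p * (1 - b * ρ) / (γ - 1) * ((1 - b * ρ') * (τ' ^ β)⁻¹) =
      (p * x ^ β) * ((1 - b * ρ) * (1 - b * ρ') / ((γ - 1) * (x ^ β * τ' ^ β))) := by field_simp
  have r : p' * (1 - b * ρ') / (γ - 1) * ((1 - b * ρ) * (x ^ β * τ' ^ β)⁻¹) =
      p' * ((1 - b * ρ) * (1 - b * ρ') / ((γ - 1) * (x ^ β * τ' ^ β))) := by field_simp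
  rw [l, r]
  exact mul_lt_mul_of_pos_right hS' (by positivity)

/-! ### Averages of Riemann fans -/

/-- The flux `flux(w) - s w` through a line moving with speed `s`. -/
noncomputable def ExtState.relFlux (b : ℝ) (w : ExtState) (s : ℝ) : ExtState :=
  ExtState.flux b w - s • w

theorem RankineHugoniot.relFlux_eq {b : ℝ} {w w' : ExtState} {s : ℝ}
    (h : RankineHugoniot b w w' s) : w.relFlux b s = w'.relFlux b s := by
  rw [RankineHugoniot, smul_sub] at h
  rw [ExtState.relFlux, ExtState.relFlux, sub_eq_sub_iff_sub_eq_sub, ← neg_sub, h, neg_sub]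

theorem ExtState.relFlux_zero (b s : ℝ) : ExtState.relFlux b 0 s = 0 := by
  simp [ExtState.relFlux, ExtState.flux, ExtState.pcov, ExtState.intEnergy]

/-- The integral of the affine functional `α + ℓ` over `s ≤ x / t ≤ s'` at `t = 1` of a fan with
value `w` at `s` and `w'` at `s'`, as given by conservation. -/
noncomputable def fanIntegral (b α : ℝ) (ℓ : ExtState →L[ℝ] ℝ) (w : ExtState) (s : ℝ)
    (w' : ExtState) (s' : ℝ) : ℝ :=
  (s' - s) * α + ℓ (w.relFlux b s - w'.relFlux b s')

theorem fanIntegral_add (b α : ℝ) (ℓ : ExtState →L[ℝ] ℝ) (w : ExtState) (s : ℝ)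
    (w' : ExtState) (s' : ℝ) (w'' : ExtState) (s'' : ℝ) :
    fanIntegral b α ℓ w s w' s' + fanIntegral b α ℓ w' s' w'' s'' =
      fanIntegral b α ℓ w s w'' s'' := by
  simp only [fanIntegral, map_sub]; ring

theorem fanIntegral_const (b α : ℝ) (ℓ : ExtState →L[ℝ] ℝ) (w : ExtState) (s s' : ℝ) :
    fanIntegral b α ℓ w s w s' = (s' - s) * (α + ℓ w) := by
  simp only [fanIntegral, ExtState.relFlux, map_sub, map_smul, smul_eq_mul]; ring

theorem RankineHugoniot.fanIntegral_eq_zero {b : ℝ} {w w' : ExtState} {s : ℝ}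
    (h : RankineHugoniot b w w' s) (α : ℝ) (ℓ : ExtState →L[ℝ] ℝ) :
    fanIntegral b α ℓ w s w' s = 0 := by
  simp [fanIntegral, h.relFlux_eq]

theorem ExtState.continuousAt_flux {b : ℝ} {w : ExtState} (h : w ∈ ExtState.admissible b) :
    ContinuousAt (ExtState.flux b) w := by
  obtain ⟨h1, h2, -⟩ := h
  have h1' := h1.ne'
  have h2' := h2.ne'
  have h3 : 2 * w.1 ≠ 0 := by positivity
  have hp : ContinuousAt (ExtState.pcov b) w := by
    unfold ExtState.pcov ExtState.gam ExtState.intEnergy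
    fun_prop (disch := assumption)
  unfold ExtState.flux
  fun_prop (disch := assumption)

theorem Family.continuousAt_speed {b : ℝ} {w : ExtState} (k : Family)
    (h : w ∈ ExtState.admissible b) : ContinuousAt (fun w => k.speed b w) w := by
  obtain ⟨h1, h2, -⟩ := h
  have h1' := h1.ne'
  have h2' := h2.ne'
  have h3 : 2 * w.1 ≠ 0 := by positivity
  have h4 : w.1 * (1 - b * w.1) ≠ 0 := mul_ne_zero h1' h2'
  have hv : ContinuousAt ExtState.vel w := by
    unfold ExtState.vel
    fun_prop (disch := assumption)
  have ha : ContinuousAt (ExtState.soundSpeed b) w := by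
    unfold ExtState.soundSpeed ExtState.pcov ExtState.gam ExtState.intEnergy
    fun_prop (disch := assumption)
  cases k <;> simp only [Family.speed]
  · exact hv.sub ha
  · exact hv.add ha

/-- The edges of a rarefaction wave move with the characteristic speeds of its end states. -/
theorem IsRarefaction.speed_eq {b : ℝ} {k : Family} {w w' : ExtState} {s s' : ℝ}
    {R : ℝ → ExtState} (h : IsRarefaction b k w w' s s' R) {ξ : ℝ} (hξ : ξ ∈ Set.Icc s s')
    (hR : R ξ ∈ ExtState.admissible b) : k.speed b (R ξ) = ξ := by
  obtain ⟨hs, -, -, hc, hI⟩ := h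
  have hcl : (nhdsWithin ξ (Set.Ioo s s')).NeBot := by
    rw [← mem_closure_iff_nhdsWithin_neBot, closure_Ioo hs.ne]
    exact hξ
  have h1 : Filter.Tendsto (fun x => k.speed b (R x)) (nhdsWithin ξ (Set.Ioo s s'))
      (nhds (k.speed b (R ξ))) :=
    (k.continuousAt_speed hR).tendsto.comp
      ((hc ξ hξ).mono Set.Ioo_subset_Icc_self).tendsto
  have h2 : Filter.Tendsto (fun x => k.speed b (R x)) (nhdsWithin ξ (Set.Ioo s s'))
      (nhds ξ) := by
    refine Filter.Tendsto.congr' ?_ (tendsto_nhdsWithin_of_tendsto_nhds Filter.tendsto_id)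
    filter_upwards [self_mem_nhdsWithin] with x hx
    exact (hI x hx).2.1.symm
  exact tendsto_nhds_unique h1 h2

section Rarefaction

variable {b α : ℝ} {ℓ : ExtState →L[ℝ] ℝ} {k : Family} {w w' : ExtState} {s s' : ℝ}
  {R : ℝ → ExtState}

/-- Along a rarefaction `-(flux(R) - ξ R)` has derivative `R`. -/
theorem IsRarefaction.strictMonoOn (h : IsRarefaction b k w w' s s' R)
    (hℓ : ∀ w ∈ ExtState.admissible b, 0 < α + ℓ w) {D : Set ℝ} (hD : Convex ℝ D)
    (hDi : interior D ⊆ Set.Ioo s s')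
    (hc : ContinuousOn (fun ξ => ℓ ((R ξ).relFlux b ξ)) D) :
    StrictMonoOn (fun ξ => α * ξ - ℓ ((R ξ).relFlux b ξ)) D := by
  refine strictMonoOn_of_deriv_pos hD ((by fun_prop : ContinuousOn (fun ξ => α * ξ) D).sub hc)
    fun ξ hξ => ?_
  obtain ⟨hadm, -, R', hR, hF⟩ := h.2.2.2.2 ξ (hDi hξ)
  have h1 : HasDerivAt (fun ξ => (R ξ).relFlux b ξ) (-(R ξ)) ξ := by
    have h0 := hF.sub ((hasDerivAt_id ξ).smul hR)
    have e : ξ • R' - (id ξ • R' + (1 : ℝ) • R ξ) = -(R ξ) := by simp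
    rw [e] at h0
    exact h0
  have h2 := ((hasDerivAt_id ξ).const_mul α).sub (ℓ.hasFDerivAt.comp_hasDerivAt ξ h1)
  have h3 : deriv (fun ξ => α * ξ - ℓ ((R ξ).relFlux b ξ)) ξ = α + ℓ (R ξ) := by
    have := h2.deriv
    simp only [map_neg, mul_one, sub_neg_eq_add] at this
    exact this
  rw [h3]
  exact hℓ _ hadm

theorem IsRarefaction.continuousOn_relFlux (h : IsRarefaction b k w w' s s' R) {D : Set ℝ}
    (hD : D ⊆ Set.Icc s s') (hadm : ∀ ξ ∈ D, R ξ ∈ ExtState.admissible b) :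
    ContinuousOn (fun ξ => ℓ ((R ξ).relFlux b ξ)) D := by
  have hR : ContinuousOn R D := h.2.2.2.1.mono hD
  have hF : ContinuousOn (fun ξ => ExtState.flux b (R ξ)) D := fun ξ hξ =>
    (ExtState.continuousAt_flux (hadm ξ hξ)).comp_continuousWithinAt (hR ξ hξ)
  unfold ExtState.relFlux
  fun_prop

theorem IsRarefaction.fanIntegral_pos (h : IsRarefaction b k w w' s s' R)
    (hw : w ∈ ExtState.admissible b) (hw' : w' ∈ ExtState.admissible b)
    (hℓ : ∀ w ∈ ExtState.admissible b, 0 < α + ℓ w) :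
    0 < fanIntegral b α ℓ w s w' s' := by
  have hs := h.1
  have hadm : ∀ ξ ∈ Set.Icc s s', R ξ ∈ ExtState.admissible b := by
    intro ξ hξ
    rcases hξ.1.eq_or_lt with h1 | h1
    · rw [← h1, h.2.1]; exact hw
    rcases hξ.2.eq_or_lt with h2 | h2
    · rw [h2, h.2.2.1]; exact hw'
    exact (h.2.2.2.2 ξ ⟨h1, h2⟩).1
  have := h.strictMonoOn hℓ (convex_Icc s s') interior_Icc.subset
    (h.continuousOn_relFlux subset_rfl hadm) (Set.left_mem_Icc.2 hs.le)
    (Set.right_mem_Icc.2 hs.le) hs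
  simp only [h.2.1, h.2.2.1] at this
  rw [fanIntegral, map_sub]
  linarith

/-- The functionals used to test fans that reach the vacuum: either functionals of the density, or
linear functionals whose flux through an acoustic characteristic has the sign of the relative
velocity. For both, the flux vanishes or has a favourable sign at the edge of the vacuum. -/
def VacuumTest (b α : ℝ) (ℓ : ExtState →L[ℝ] ℝ) : Prop :=
  (∃ x : ℝ, ∀ w : ExtState, ℓ w = x * w.1) ∨
    (α = 0 ∧ ∀ w ∈ ExtState.admissible b, ∀ ξ : ℝ, (w.vel - ξ) ^ 2 = w.soundSpeed b ^ 2 →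
      (0 ≤ w.vel - ξ → 0 ≤ ℓ (w.relFlux b ξ)) ∧ (w.vel - ξ ≤ 0 → ℓ (w.relFlux b ξ) ≤ 0))

theorem continuousOn_density_relFlux {D : Set ℝ} (hR : ContinuousOn R D) {x : ℝ}
    (hx : ∀ w : ExtState, ℓ w = x * w.1) :
    ContinuousOn (fun ξ => ℓ ((R ξ).relFlux b ξ)) D := by
  simp only [hx, ExtState.relFlux, ExtState.flux, Prod.fst_sub, Prod.smul_fst, smul_eq_mul]
  fun_prop

theorem IsRarefaction.fanIntegral_pos_of_vacuum_right
    (h : IsRarefaction b .left w 0 s s' R) (hw : w ∈ ExtState.admissible b)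
    (hℓ : ∀ w ∈ ExtState.admissible b, 0 < α + ℓ w) (hv : VacuumTest b α ℓ) :
    0 < fanIntegral b α ℓ w s 0 s' := by
  have hs := h.1
  obtain ⟨x, hx⟩ | ⟨rfl, hx⟩ := hv
  · have := h.strictMonoOn hℓ (convex_Icc s s') interior_Icc.subset
      (continuousOn_density_relFlux h.2.2.2.1 hx) (Set.left_mem_Icc.2 hs.le)
      (Set.right_mem_Icc.2 hs.le) hs
    simp only [h.2.1, h.2.2.1] at this
    rw [fanIntegral, map_sub]
    linarith
  -- the integral up to an interior point `ξ` is at most that up to the vacuum, by the sign of the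
  -- flux at `ξ`
  · have hadm : ∀ ξ ∈ Set.Ico s s', R ξ ∈ ExtState.admissible b := by
      intro ξ hξ
      rcases hξ.1.eq_or_lt with h1 | h1
      · rw [← h1, h.2.1]; exact hw
      exact (h.2.2.2.2 ξ ⟨h1, hξ.2⟩).1
    obtain ⟨ξ, hξ⟩ := exists_between hs
    have hm := h.strictMonoOn hℓ (convex_Ico s s') interior_Ico.subset
      (h.continuousOn_relFlux Set.Ico_subset_Icc_self hadm)
    have h1 := hm (Set.left_mem_Ico.2 hs) ⟨hξ.1.le, hξ.2⟩ hξ.1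
    have hA := hadm ξ ⟨hξ.1.le, hξ.2⟩
    have hsp := (h.2.2.2.2 ξ hξ).2.1
    simp only [Family.speed] at hsp
    have ha : (R ξ).vel - ξ = (R ξ).soundSpeed b := by linarith
    have h3 := (hx _ hA ξ (by rw [ha])).1 (ha ▸ ExtState.soundSpeed_nonneg b _)
    rw [fanIntegral, ExtState.relFlux_zero, sub_zero]
    simp only [h.2.1, zero_mul, zero_sub, neg_lt_neg_iff] at h1
    linarith

theorem IsRarefaction.fanIntegral_pos_of_vacuum_left
    (h : IsRarefaction b .right 0 w s s' R) (hw : w ∈ ExtState.admissible b)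
    (hℓ : ∀ w ∈ ExtState.admissible b, 0 < α + ℓ w) (hv : VacuumTest b α ℓ) :
    0 < fanIntegral b α ℓ 0 s w s' := by
  have hs := h.1
  obtain ⟨x, hx⟩ | ⟨rfl, hx⟩ := hv
  · have := h.strictMonoOn hℓ (convex_Icc s s') interior_Icc.subset
      (continuousOn_density_relFlux h.2.2.2.1 hx) (Set.left_mem_Icc.2 hs.le)
      (Set.right_mem_Icc.2 hs.le) hs
    simp only [h.2.1, h.2.2.1] at this
    rw [fanIntegral, map_sub]
    linarith
  · have hadm : ∀ ξ ∈ Set.Ioc s s', R ξ ∈ ExtState.admissible b := by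
      intro ξ hξ
      rcases hξ.2.eq_or_lt with h1 | h1
      · rw [h1, h.2.2.1]; exact hw
      exact (h.2.2.2.2 ξ ⟨hξ.1, h1⟩).1
    obtain ⟨ξ, hξ⟩ := exists_between hs
    have hm := h.strictMonoOn hℓ (convex_Ioc s s') interior_Ioc.subset
      (h.continuousOn_relFlux Set.Ioc_subset_Icc_self hadm)
    have h1 := hm ⟨hξ.1, hξ.2.le⟩ (Set.right_mem_Ioc.2 hs) hξ.2
    have hA := hadm ξ ⟨hξ.1, hξ.2.le⟩
    have hsp := (h.2.2.2.2 ξ hξ).2.1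
    simp only [Family.speed] at hsp
    have ha : (R ξ).vel - ξ = -(R ξ).soundSpeed b := by linarith
    have h3 := (hx _ hA ξ (by rw [ha, neg_sq])).2
      (ha ▸ neg_nonpos.2 (ExtState.soundSpeed_nonneg b _))
    rw [fanIntegral, ExtState.relFlux_zero, zero_sub, map_neg]
    simp only [h.2.2.1, zero_mul, zero_sub, neg_lt_neg_iff] at h1
    linarith

/-- A left acoustic wave together with the constant states next to it. -/
theorem AcousticWave.Connects.fanIntegral_left {W : AcousticWave} {lam : ℝ}
    (h : W.Connects b .left w w') (hw : w ∈ ExtState.admissible b)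
    (hw' : w' ∈ ExtState.admissible b) (hlam : ∀ s ∈ W.speeds, -lam ≤ s)
    (hv : -lam ≤ w'.vel) (hℓ : ∀ w ∈ ExtState.admissible b, 0 < α + ℓ w) :
    -lam ≤ w.vel ∧ 0 ≤ fanIntegral b α ℓ w (-lam) w' w'.vel ∧
      (-lam < w'.vel → 0 < fanIntegral b α ℓ w (-lam) w' w'.vel) := by
  have pw := hℓ _ hw
  have pw' := hℓ _ hw'
  cases W with
  | absent =>
    obtain rfl : w = w' := h
    rw [fanIntegral_const]
    exact ⟨hv, mul_nonneg (by linarith) pw.le, fun h => mul_pos (by linarith) pw⟩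
  | shock s =>
    obtain ⟨-, -, hRH, hl1, hl2, hl3⟩ := h
    have hs := hlam s rfl
    have ha := ExtState.soundSpeed_nonneg b w
    simp only [Family.speed] at hl1
    rw [← fanIntegral_add b α ℓ w (-lam) w s w', ← fanIntegral_add b α ℓ w s w' s w',
      hRH.fanIntegral_eq_zero, fanIntegral_const, fanIntegral_const, zero_add]
    have h1 : 0 ≤ (s - -lam) * (α + ℓ w) := mul_nonneg (by linarith) pw.le
    have h2 : 0 < (w'.vel - s) * (α + ℓ w') := mul_pos (by linarith) pw'
    exact ⟨by linarith, by linarith, fun _ => by linarith⟩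
  | rarefaction s s' R =>
    have h : IsRarefaction b .left w w' s s' R := h
    have hs := hlam s (Set.left_mem_Icc.2 h.1.le)
    have hpos := h.fanIntegral_pos hw hw' hℓ
    have e1 := h.speed_eq (Set.left_mem_Icc.2 h.1.le) (h.2.1.symm ▸ hw)
    have e2 := h.speed_eq (Set.right_mem_Icc.2 h.1.le) (h.2.2.1.symm ▸ hw')
    rw [h.2.1] at e1
    rw [h.2.2.1] at e2
    simp only [Family.speed] at e1 e2
    have ha := ExtState.soundSpeed_nonneg b w
    have ha' := ExtState.soundSpeed_nonneg b w'
    rw [← fanIntegral_add b α ℓ w (-lam) w s w', ← fanIntegral_add b α ℓ w s w' s' w',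
      fanIntegral_const, fanIntegral_const]
    have h1 : 0 ≤ (s - -lam) * (α + ℓ w) := mul_nonneg (by linarith) pw.le
    have h2 : 0 ≤ (w'.vel - s') * (α + ℓ w') := mul_nonneg (by linarith) pw'.le
    exact ⟨by linarith, by linarith, fun _ => by linarith⟩

/-- A right acoustic wave together with the constant states next to it. -/
theorem AcousticWave.Connects.fanIntegral_right {W : AcousticWave} {lam : ℝ}
    (h : W.Connects b .right w w') (hw : w ∈ ExtState.admissible b)
    (hw' : w' ∈ ExtState.admissible b) (hlam : ∀ s ∈ W.speeds, s ≤ lam)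
    (hv : w.vel ≤ lam) (hℓ : ∀ w ∈ ExtState.admissible b, 0 < α + ℓ w) :
    w'.vel ≤ lam ∧ 0 ≤ fanIntegral b α ℓ w w.vel w' lam ∧
      (w.vel < lam → 0 < fanIntegral b α ℓ w w.vel w' lam) := by
  have pw := hℓ _ hw
  have pw' := hℓ _ hw'
  cases W with
  | absent =>
    obtain rfl : w = w' := h
    rw [fanIntegral_const]
    exact ⟨hv, mul_nonneg (by linarith) pw.le, fun h => mul_pos (by linarith) pw⟩
  | shock s =>
    obtain ⟨-, -, hRH, hl1, hl2, hl3⟩ := h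
    have hs := hlam s rfl
    have ha := ExtState.soundSpeed_nonneg b w'
    simp only [Family.speed] at hl3
    rw [← fanIntegral_add b α ℓ w w.vel w s w', ← fanIntegral_add b α ℓ w s w' s w',
      hRH.fanIntegral_eq_zero, fanIntegral_const, fanIntegral_const, zero_add]
    have h1 : 0 < (s - w.vel) * (α + ℓ w) := mul_pos (by linarith) pw
    have h2 : 0 ≤ (lam - s) * (α + ℓ w') := mul_nonneg (by linarith) pw'.le
    exact ⟨by linarith, by linarith, fun _ => by linarith⟩
  | rarefaction s s' R =>
    have h : IsRarefaction b .right w w' s s' R := h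
    have hs := hlam s' (Set.right_mem_Icc.2 h.1.le)
    have hpos := h.fanIntegral_pos hw hw' hℓ
    have e1 := h.speed_eq (Set.left_mem_Icc.2 h.1.le) (h.2.1.symm ▸ hw)
    have e2 := h.speed_eq (Set.right_mem_Icc.2 h.1.le) (h.2.2.1.symm ▸ hw')
    rw [h.2.1] at e1
    rw [h.2.2.1] at e2
    simp only [Family.speed] at e1 e2
    have ha := ExtState.soundSpeed_nonneg b w
    have ha' := ExtState.soundSpeed_nonneg b w'
    rw [← fanIntegral_add b α ℓ w w.vel w s w', ← fanIntegral_add b α ℓ w s w' s' w',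
      fanIntegral_const, fanIntegral_const]
    have h1 : 0 ≤ (s - w.vel) * (α + ℓ w) := mul_nonneg (by linarith) pw.le
    have h2 : 0 ≤ (lam - s') * (α + ℓ w') := mul_nonneg (by linarith) pw'.le
    exact ⟨by linarith, by linarith, fun _ => by linarith⟩

end Rarefaction

/-- The average over `|x / t| ≤ lam` of a fan whose waves have speeds at most `lam` inherits the
positive affine functionals of the admissible states. -/
theorem RiemannFan.Solves.fanIntegral_pos {b α lam : ℝ} {ℓ : ExtState →L[ℝ] ℝ}
    {wL wR : ExtState} {F : RiemannFan} (h : F.Solves b wL wR) (hL : wL ∈ ExtState.admissible b)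
    (hR : wR ∈ ExtState.admissible b) (hlam : 0 < lam) (hF : ∀ s ∈ F.speeds, |s| ≤ lam)
    (hα : 0 ≤ α) (hℓ : ∀ w ∈ ExtState.admissible b, 0 < α + ℓ w) (hv : VacuumTest b α ℓ) :
    -lam ≤ wL.vel ∧ wR.vel ≤ lam ∧ 0 < fanIntegral b α ℓ wL (-lam) wR lam := by
  cases F with
  | contact W₁ w₁ w₂ v W₃ =>
    obtain ⟨h1, ⟨hw1, hw2, hv1, hv2, hRH⟩, h3⟩ := h
    have hvb := abs_le.1 (hF v (Or.inl (Or.inr rfl)))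
    obtain ⟨a1, a2, a3⟩ := h1.fanIntegral_left hL hw1
      (fun s hs => (abs_le.1 (hF s (Or.inl (Or.inl hs)))).1) (hv1 ▸ hvb.1) hℓ
    obtain ⟨b1, b2, b3⟩ := h3.fanIntegral_right hw2 hR
      (fun s hs => (abs_le.1 (hF s (Or.inr hs))).2) (hv2 ▸ hvb.2) hℓ
    refine ⟨a1, b1, ?_⟩
    rw [hv1] at a2 a3
    rw [hv2] at b2 b3
    rw [← fanIntegral_add b α ℓ wL (-lam) w₁ v wR, ← fanIntegral_add b α ℓ w₁ v w₂ v wR,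
      hRH.fanIntegral_eq_zero, zero_add]
    rcases hvb.1.lt_or_eq with h0 | h0
    · have := a3 h0
      linarith
    · have := b3 (by linarith)
      linarith
  | vacuum s₁ s₁' R₁ s₃ s₃' R₃ =>
    obtain ⟨h1, h2, h3⟩ := h
    have c1 := (abs_le.1 (hF s₁ (Or.inl (Set.left_mem_Icc.2 h1.1.le)))).1
    have c3 := (abs_le.1 (hF s₃' (Or.inr (Set.right_mem_Icc.2 h3.1.le)))).2
    have e1 := h1.speed_eq (Set.left_mem_Icc.2 h1.1.le) (h1.2.1.symm ▸ hL)
    have e2 := h3.speed_eq (Set.right_mem_Icc.2 h3.1.le) (h3.2.2.1.symm ▸ hR)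
    rw [h1.2.1] at e1
    rw [h3.2.2.1] at e2
    simp only [Family.speed] at e1 e2
    have ha := ExtState.soundSpeed_nonneg b wL
    have ha' := ExtState.soundSpeed_nonneg b wR
    have p1 := h1.fanIntegral_pos_of_vacuum_right hL hℓ hv
    have p3 := h3.fanIntegral_pos_of_vacuum_left hR hℓ hv
    refine ⟨by linarith, by linarith, ?_⟩
    rw [← fanIntegral_add b α ℓ wL (-lam) wL s₁ wR, ← fanIntegral_add b α ℓ wL s₁ 0 s₁' wR,
      ← fanIntegral_add b α ℓ 0 s₁' 0 s₃ wR, ← fanIntegral_add b α ℓ 0 s₃ wR s₃' wR,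
      fanIntegral_const, fanIntegral_const, fanIntegral_const, map_zero, add_zero]
    have q1 : 0 ≤ (s₁ - -lam) * (α + ℓ wL) := mul_nonneg (by linarith) (hℓ _ hL).le
    have q2 : 0 ≤ (s₃ - s₁') * α := mul_nonneg (by linarith) hα
    have q3 : 0 ≤ (lam - s₃') * (α + ℓ wR) := mul_nonneg (by linarith) (hℓ _ hR).le
    linarith

/-- The energy `𝓔 - k m + k² ρ / 2` in a frame moving with velocity `k`. -/
noncomputable def ExtState.frameEnergy (k : ℝ) : ExtState →L[ℝ] ℝ :=
  (ContinuousLinearMap.fst ℝ ℝ ℝ) ∘L (ContinuousLinearMap.snd ℝ ℝ (ℝ × ℝ)) ∘L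
      (ContinuousLinearMap.snd ℝ ℝ (ℝ × ℝ × ℝ)) -
    k • ((ContinuousLinearMap.fst ℝ ℝ (ℝ × ℝ)) ∘L (ContinuousLinearMap.snd ℝ ℝ (ℝ × ℝ × ℝ))) +
    (k ^ 2 / 2) • ContinuousLinearMap.fst ℝ ℝ (ℝ × ℝ × ℝ)

theorem ExtState.frameEnergy_apply (k : ℝ) (w : ExtState) :
    ExtState.frameEnergy k w = w.2.2.1 - k * w.2.1 + k ^ 2 / 2 * w.1 := rfl

theorem ExtState.frameEnergy_eq (k : ℝ) {w : ExtState} (h : 0 < w.1) :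
    ExtState.frameEnergy k w = w.intEnergy + w.1 / 2 * (w.vel - k) ^ 2 := by
  rw [ExtState.frameEnergy_apply, ExtState.energy_eq h]
  rw [ExtState.vel_mul_fst h]
  ring

theorem ExtState.frameEnergy_pos (k : ℝ) {b : ℝ} {w : ExtState}
    (h : w ∈ ExtState.admissible b) : 0 < ExtState.frameEnergy k w := by
  rw [ExtState.frameEnergy_eq k h.1]
  have h1 := h.1
  have h2 := h.2.2.1
  positivity

theorem ExtState.frameEnergy_relFlux {b ξ : ℝ} (k : ℝ) {w : ExtState} (h : 0 < w.1) :
    ExtState.frameEnergy k (w.relFlux b ξ) =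
      (w.vel - ξ) * (w.intEnergy + w.1 / 2 * (w.vel - k) ^ 2) + w.pcov b * (w.vel - k) := by
  rw [← ExtState.frameEnergy_eq k h, ExtState.frameEnergy_apply, ExtState.frameEnergy_apply,
    ExtState.relFlux, ExtState.flux_eq h]
  simp only [Prod.fst_sub, Prod.snd_sub, Prod.smul_fst, Prod.smul_snd, smul_eq_mul]
  rw [ExtState.vel_mul_fst h]
  ring

/-- Through a characteristic the pressure work is dominated by the energy transport: this is
`p² ≤ ρ² a² e`. -/
theorem ExtState.vacuumTest_frameEnergy (b k : ℝ) : VacuumTest b 0 (ExtState.frameEnergy k) := by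
  refine Or.inr ⟨rfl, fun w hw ξ hξ => ?_⟩
  rw [ExtState.frameEnergy_relFlux k hw.1]
  have hp0 := ExtState.pcov_nonneg hw
  have ha := ExtState.soundSpeed_sq hw
  have hp := ExtState.pcov_mul hw.2.1
  rw [← hξ] at ha
  obtain ⟨h1, h2, h3, h4⟩ := hw
  generalize w.vel - ξ = y at *
  generalize w.vel - k = z at *
  generalize w.pcov b = p at *
  generalize w.gam = γ at *
  generalize w.intEnergy = e at *
  generalize w.1 = ρ at *
  have key : p ^ 2 ≤ y ^ 2 * ρ * e := by
    refine le_of_mul_le_mul_right ?_ h2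
    calc p ^ 2 * (1 - b * ρ) = (γ - 1) * (p * e) := by linear_combination p * hp
      _ ≤ γ * (p * e) := by
        have : 0 ≤ p * e := mul_nonneg hp0 h3.le
        nlinarith
      _ = y ^ 2 * ρ * e * (1 - b * ρ) := by linear_combination -e * ha
  -- completing the square in `z`
  have hmain : 0 ≤ y * (y * (e + ρ / 2 * z ^ 2) + p * z) := by
    have e1 : 2 * ρ * (y * (y * (e + ρ / 2 * z ^ 2) + p * z)) =
        2 * (y ^ 2 * ρ * e) - p ^ 2 + (ρ * y * z + p) ^ 2 := by ring
    have : 0 ≤ 2 * ρ * (y * (y * (e + ρ / 2 * z ^ 2) + p * z)) := by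
      rw [e1]; nlinarith [sq_nonneg (ρ * y * z + p), sq_nonneg p]
    exact nonneg_of_mul_nonneg_right this (by linarith)
  have hp0' : y = 0 → p = 0 := by
    rintro rfl
    have : p ^ 2 ≤ 0 := by simpa using key
    exact pow_eq_zero_iff two_ne_zero |>.1 (le_antisymm this (sq_nonneg p))
  constructor
  · intro hy
    rcases hy.eq_or_lt with h | h
    · simp [hp0' h.symm, ← h]
    · exact nonneg_of_mul_nonneg_right hmain h
  · intro hy
    rcases hy.eq_or_lt with h | h
    · simp [hp0' h, h]
    · exact nonpos_of_mul_nonneg_right hmain h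

/-! ### Rarefaction waves -/

/-- The state on a left rarefaction curve with Riemann invariant `A`: it has density
`ρ = σ / (1 + b σ)`, velocity `A - q c` and pressure `c² σ / γ`, where `γ = 1 + 2 / q` and
`c = √(γ p (1 / ρ - b))`. -/
noncomputable def rarefactionState (b q A σ c : ℝ) : ExtState :=
  (σ / (1 + b * σ), σ / (1 + b * σ) * (A - q * c),
    σ / (1 + b * σ) * ((A - q * c) ^ 2 / 2 + q ^ 2 * c ^ 2 / (2 * (q + 2))),
    (1 + 2 / q) * (σ / (1 + b * σ)))

section RarefactionState

variable {b q A σ c : ℝ}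

theorem rarefactionState_vel (hb : 0 ≤ b) (hσ : 0 < σ) :
    (rarefactionState b q A σ c).vel = A - q * c := by
  have : 0 < 1 + b * σ := by positivity
  rw [ExtState.vel, rarefactionState]
  field_simp

theorem rarefactionState_gam (hb : 0 ≤ b) (hσ : 0 < σ) :
    (rarefactionState b q A σ c).gam = 1 + 2 / q := by
  have : 0 < 1 + b * σ := by positivity
  rw [ExtState.gam, rarefactionState]
  exact mul_div_cancel_right₀ _ (by positivity)

theorem rarefactionState_intEnergy (hb : 0 ≤ b) (hσ : 0 < σ) :
    (rarefactionState b q A σ c).intEnergy =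
      σ / (1 + b * σ) * (q ^ 2 * c ^ 2 / (2 * (q + 2))) := by
  have : 0 < 1 + b * σ := by positivity
  have h2 : 0 < σ / (1 + b * σ) := by positivity
  simp only [ExtState.intEnergy, rarefactionState]
  generalize σ / (1 + b * σ) = ρ at *
  field_simp
  ring

theorem rarefactionState_covolume (hb : 0 ≤ b) (hσ : 0 < σ) :
    1 - b * (rarefactionState b q A σ c).1 = 1 / (1 + b * σ) := by
  have : 0 < 1 + b * σ := by positivity
  simp only [rarefactionState]
  field_simp
  ring

theorem rarefactionState_pcov (hb : 0 ≤ b) (hq : 0 < q) (hσ : 0 < σ) :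
    (rarefactionState b q A σ c).pcov b = c ^ 2 * σ * (q / (q + 2)) := by
  have : 0 < 1 + b * σ := by positivity
  rw [ExtState.pcov, rarefactionState_gam hb hσ, rarefactionState_intEnergy hb hσ,
    rarefactionState_covolume hb hσ]
  field_simp
  ring

theorem rarefactionState_soundSpeed (hb : 0 ≤ b) (hq : 0 < q) (hσ : 0 < σ) (hc : 0 ≤ c) :
    (rarefactionState b q A σ c).soundSpeed b = c * (1 + b * σ) := by
  have : 0 < 1 + b * σ := by positivity
  rw [ExtState.soundSpeed, rarefactionState_gam hb hσ, rarefactionState_pcov hb hq hσ,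
    rarefactionState_covolume hb hσ]
  have e : (1 + 2 / q) * (c ^ 2 * σ * (q / (q + 2))) /
      ((rarefactionState b q A σ c).1 * (1 / (1 + b * σ))) = (c * (1 + b * σ)) ^ 2 := by
    simp only [rarefactionState]
    field_simp
  rw [e, Real.sqrt_sq (by positivity)]

theorem rarefactionState_mem (hb : 0 ≤ b) (hq : 0 < q) (hσ : 0 < σ) (hc : 0 < c) :
    rarefactionState b q A σ c ∈ ExtState.admissible b := by
  have : 0 < 1 + b * σ := by positivity
  refine ⟨?_, ?_, ?_, ?_⟩
  · simp only [rarefactionState]; positivity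
  · rw [rarefactionState_covolume hb hσ]; positivity
  · rw [rarefactionState_intEnergy hb hσ]; positivity
  · rw [rarefactionState_gam hb hσ]
    have : 0 < 2 / q := by positivity
    linarith

/-- Along the curve `σ' = q σ / c` the characteristic equation `flux' = (v - a) state'` holds. -/
theorem hasDerivAt_rarefactionState {σ : ℝ → ℝ} (hb : 0 ≤ b) (hq : 0 < q) (hσ0 : 0 < σ c)
    (hc : 0 < c) (hσ : HasDerivAt σ (q * σ c / c) c) :
    ∃ D : ExtState, HasDerivAt (fun x => rarefactionState b q A (σ x) x) D c ∧
      HasDerivAt (fun x => ExtState.flux b (rarefactionState b q A (σ x) x))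
        ((A - q * c - c * (1 + b * σ c)) • D) c := by
  have h1 : 0 < 1 + b * σ c := by positivity
  have hρ := hσ.fun_div ((hσ.const_mul b).const_add 1) h1.ne'
  have hv : HasDerivAt (fun x => A - q * x) (-q) c := by
    simpa using ((hasDerivAt_id c).const_mul q).const_sub A
  have hcc : HasDerivAt (fun x : ℝ => x ^ 2) (2 * c) c := by simpa using hasDerivAt_pow 2 c
  have hE := hρ.fun_mul (((hv.fun_pow 2).div_const 2).fun_add
    ((hcc.const_mul (q ^ 2)).div_const (2 * (q + 2))))
  have hst := hρ.prodMk ((hρ.fun_mul hv).prodMk (hE.prodMk (hρ.const_mul (1 + 2 / q))))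
  refine ⟨_, hst, ?_⟩
  have hp := (hcc.fun_mul hσ).mul_const (q / (q + 2))
  have hfl := (hv.fun_mul hρ).prodMk ((((hv.fun_pow 2).fun_mul hρ).fun_add hp).prodMk
    ((hv.fun_mul (hE.fun_add hp)).prodMk ((hv.mul_const (1 + 2 / q)).fun_mul hρ)))
  refine (hfl.congr_of_eventuallyEq ?_).congr_deriv ?_
  · filter_upwards [hσ.continuousAt.eventually (lt_mem_nhds hσ0)] with x hx
    have hx1 : 0 < 1 + b * σ x := by positivity
    rw [ExtState.flux_eq (by simp only [rarefactionState]; positivity),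
      rarefactionState_vel hb hx, rarefactionState_gam hb hx, rarefactionState_pcov hb hq hx]
    simp only [rarefactionState]
  · simp only [Prod.smul_mk, smul_eq_mul]
    refine Prod.ext ?_ (Prod.ext ?_ (Prod.ext ?_ ?_)) <;> simp only <;> field_simp <;> ring

end RarefactionState

/-- The self-similar coordinate `(q + 1) c + b c σ` of a rarefaction wave, up to sign and a
constant, as a function of `c`; `σ = σ₀ (c / c₀) ^ q`. It is extended to negative `c` so as to be a
homeomorphism of the line. -/
noncomputable def rarefactionCoord (b q σ₀ c₀ c : ℝ) : ℝ :=
  (q + 1) * c + b * (max c 0 * (σ₀ * (max c 0 / c₀) ^ q))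

section RarefactionCoord

variable {b q σ₀ c₀ : ℝ}

theorem strictMono_rarefactionCoord (hb : 0 ≤ b) (hq : 0 < q) (hσ : 0 < σ₀) (hc : 0 < c₀) :
    StrictMono (rarefactionCoord b q σ₀ c₀) := by
  intro x y hxy
  unfold rarefactionCoord
  have h1 : max x 0 ≤ max y 0 := max_le_max hxy.le le_rfl
  have h0 : 0 ≤ max x 0 := le_max_right _ _
  have h0' : 0 ≤ max y 0 := le_max_right _ _
  refine add_lt_add_of_lt_of_le (by nlinarith) ?_
  gcongr

theorem continuous_rarefactionCoord (hq : 0 < q) :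
    Continuous (rarefactionCoord b q σ₀ c₀) := by
  have : Continuous fun x : ℝ => (max x 0 / c₀) ^ q :=
    ((continuous_id.max continuous_const).div_const c₀).rpow_const fun _ => Or.inr hq.le
  unfold rarefactionCoord
  fun_prop

theorem surjective_rarefactionCoord (hb : 0 ≤ b) (hq : 0 < q) (hσ : 0 < σ₀) (hc : 0 < c₀) :
    Function.Surjective (rarefactionCoord b q σ₀ c₀) := by
  have hlin : Filter.Tendsto (fun x : ℝ => (q + 1) * x) Filter.atTop Filter.atTop :=
    Filter.tendsto_id.const_mul_atTop (by linarith)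
  have hlin' : Filter.Tendsto (fun x : ℝ => (q + 1) * x) Filter.atBot Filter.atBot :=
    Filter.tendsto_id.const_mul_atBot (by linarith)
  refine (continuous_rarefactionCoord hq).surjective
    (Filter.tendsto_atTop_mono (fun x => ?_) hlin) (hlin'.congr' ?_)
  · unfold rarefactionCoord
    have h0 : 0 ≤ max x 0 := le_max_right _ _
    have : 0 ≤ b * (max x 0 * (σ₀ * (max x 0 / c₀) ^ q)) := by positivity
    linarith
  · filter_upwards [Filter.eventually_le_atBot 0] with x hx
    simp [rarefactionCoord, max_eq_right hx]

/-- The curve `σ = σ₀ (c / c₀) ^ q` satisfies `σ' = q σ / c`. -/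
theorem hasDerivAt_rpow_curve {c : ℝ} (hq : 0 < q) (hc : 0 < c) (hc0 : 0 < c₀) :
    HasDerivAt (fun x => σ₀ * (max x 0 / c₀) ^ q) (q * (σ₀ * (max c 0 / c₀) ^ q) / c) c := by
  have h1 : HasDerivAt (fun x : ℝ => x / c₀) (1 / c₀) c := (hasDerivAt_id c).div_const c₀
  have h2 := (h1.rpow_const (p := q) (Or.inl (by positivity))).const_mul σ₀
  have hev : (fun x => σ₀ * (max x 0 / c₀) ^ q) =ᶠ[nhds c] fun x => σ₀ * (x / c₀) ^ q := by
    filter_upwards [lt_mem_nhds hc] with x hx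
    rw [max_eq_left hx.le]
  refine (h2.congr_of_eventuallyEq hev).congr_deriv ?_
  rw [max_eq_left hc.le, Real.rpow_sub_one (by positivity)]
  field_simp

/-- A left rarefaction from the state with `c = c₀` to the state with `c = c₁`, the vacuum if
`c₁ = 0`. -/
theorem exists_isRarefaction (A : ℝ) {c₁ : ℝ} (hb : 0 ≤ b) (hq : 0 < q) (hσ : 0 < σ₀)
    (hc₁ : 0 ≤ c₁) (hc : c₁ < c₀) :
    ∃ R, IsRarefaction b .left (rarefactionState b q A σ₀ c₀)
      (rarefactionState b q A (σ₀ * (c₁ / c₀) ^ q) c₁)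
      (A - rarefactionCoord b q σ₀ c₀ c₀) (A - rarefactionCoord b q σ₀ c₀ c₁) R := by
  have hc₀ : 0 < c₀ := hc₁.trans_lt hc
  set N := rarefactionCoord b q σ₀ c₀ with hN
  have hmono : StrictMono N := strictMono_rarefactionCoord hb hq hσ hc₀
  let e : ℝ ≃o ℝ := hmono.orderIsoOfSurjective N (surjective_rarefactionCoord hb hq hσ hc₀)
  have heN : ∀ x, e.symm (N x) = x := fun x => e.symm_apply_apply x
  have hNe : ∀ y, N (e.symm y) = y := fun y => e.apply_symm_apply y
  have hecont : Continuous e.symm := e.symm.continuous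
  let σ : ℝ → ℝ := fun x => σ₀ * (max x 0 / c₀) ^ q
  have hσcont : Continuous σ := by
    have : Continuous fun x : ℝ => (max x 0 / c₀) ^ q :=
      ((continuous_id.max continuous_const).div_const c₀).rpow_const fun _ => Or.inr hq.le
    fun_prop
  have hσ0 : ∀ x, 0 ≤ σ x := fun x => by
    have h0 : 0 ≤ max x 0 := le_max_right _ _
    simp only [σ]; positivity
  have hstate : Continuous fun x => rarefactionState b q A (σ x) x := by
    have h1 : ∀ x, 1 + b * σ x ≠ 0 := fun x => by have := hσ0 x; positivity
    unfold rarefactionState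
    fun_prop (disch := assumption)
  refine ⟨fun ξ => rarefactionState b q A (σ (e.symm (A - ξ))) (e.symm (A - ξ)),
    sub_lt_sub_left (hmono hc) A, ?_, ?_, ?_, ?_⟩
  · simp only [sub_sub_cancel, heN]
    congr 1
    simp only [σ, max_eq_left hc₀.le, div_self hc₀.ne', Real.one_rpow, mul_one]
  · simp only [sub_sub_cancel, heN]
    congr 1
    simp only [σ, max_eq_left hc₁]
  · exact (hstate.comp (hecont.comp (continuous_const.sub continuous_id))).continuousOn
  · intro ξ hξ
    set c := e.symm (A - ξ) with hcd
    have hNc : N c = A - ξ := hNe _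
    have hcpos : 0 < c := by
      have : N c₁ < N c := by rw [hNc]; linarith [hξ.2]
      exact hc₁.trans_lt (hmono.lt_iff_lt.1 this)
    have hσc : 0 < σ c := by
      simp only [σ, max_eq_left hcpos.le]
      positivity
    have hσd := hasDerivAt_rpow_curve (σ₀ := σ₀) hq hcpos hc₀
    have hξc : A - q * c - c * (1 + b * σ c) = ξ := by
      have : N c = (q + 1) * c + b * (c * σ c) := by
        rw [hN]; simp only [rarefactionCoord, σ, max_eq_left hcpos.le]
      linear_combination this - hNc
    refine ⟨rarefactionState_mem hb hq hσc hcpos, ?_, ?_⟩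
    · simp only [Family.speed]
      rw [rarefactionState_vel hb hσc, rarefactionState_soundSpeed hb hq hσc hcpos.le]
      exact hξc
    · obtain ⟨D, hD1, hD2⟩ := hasDerivAt_rarefactionState (A := A) hb hq hσc hcpos hσd
      have hmax : HasDerivAt (fun x : ℝ => max x 0) 1 c :=
        (hasDerivAt_id c).congr_of_eventuallyEq (by
          filter_upwards [lt_mem_nhds hcpos] with x hx
          exact max_eq_left hx.le)
      have hNd : HasDerivAt N ((q + 1) + b * (σ c + c * (q * σ c / c))) c := by
        have h3 := ((hasDerivAt_id c).const_mul (q + 1)).add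
          ((hmax.mul hσd).const_mul b)
        rw [mul_one, one_mul, max_eq_left hcpos.le] at h3
        refine h3.congr_deriv ?_
        simp only [σ, max_eq_left hcpos.le]
      have hNd0 : (q + 1) + b * (σ c + c * (q * σ c / c)) ≠ 0 := by positivity
      have hinv : HasDerivAt e.symm ((q + 1) + b * (σ c + c * (q * σ c / c)))⁻¹ (A - ξ) :=
        HasDerivAt.of_local_left_inverse hecont.continuousAt hNd hNd0
          (Filter.Eventually.of_forall hNe)
      have hsub : HasDerivAt (fun x : ℝ => A - x) (-1) ξ := by
        simpa using (hasDerivAt_id ξ).const_sub A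
      have hg := hinv.comp ξ hsub
      have h4 := hD1.scomp ξ hg
      have := hD2.scomp ξ hg
      rw [smul_comm] at this
      change A - q * c - c * (1 + b * (σ₀ * (max c 0 / c₀) ^ q)) = ξ at hξc
      rw [hξc] at this
      exact ⟨_, h4, this⟩

end RarefactionCoord

/-! ### Reflection of rarefaction waves -/

/-- `ExtState.reflect` as a continuous linear map. -/
noncomputable def ExtState.reflectL : ExtState →L[ℝ] ExtState :=
  (ContinuousLinearMap.fst ℝ ℝ (ℝ × ℝ × ℝ)).prod
    ((-(ContinuousLinearMap.fst ℝ ℝ (ℝ × ℝ) ∘L ContinuousLinearMap.snd ℝ ℝ (ℝ × ℝ × ℝ))).prod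
      (ContinuousLinearMap.snd ℝ ℝ (ℝ × ℝ) ∘L ContinuousLinearMap.snd ℝ ℝ (ℝ × ℝ × ℝ)))

theorem ExtState.reflectL_apply (w : ExtState) : ExtState.reflectL w = w.reflect := rfl

theorem IsRarefaction.reflect_left {b : ℝ} {w w' : ExtState} {s s' : ℝ} {R : ℝ → ExtState}
    (h : IsRarefaction b .left w w' s s' R) :
    IsRarefaction b .right w'.reflect w.reflect (-s') (-s) fun ξ => (R (-ξ)).reflect := by
  obtain ⟨hs, h1, h2, hc, hI⟩ := h
  refine ⟨neg_lt_neg hs, by simp [h2], by simp [h1], ?_, fun ξ hξ => ?_⟩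
  · refine ExtState.reflectL.continuous.comp_continuousOn
      (hc.comp continuous_neg.continuousOn fun ξ hξ => ?_)
    exact ⟨by linarith [hξ.2], by linarith [hξ.1]⟩
  · obtain ⟨hadm, hsp, R', hR, hF⟩ := hI (-ξ) ⟨by linarith [hξ.2], by linarith [hξ.1]⟩
    refine ⟨by simpa, ?_, -R'.reflect, ?_, ?_⟩
    · simp only [Family.speed, ExtState.reflect_vel, ExtState.reflect_soundSpeed] at hsp ⊢
      linarith
    · have h3 := ExtState.reflectL.hasFDerivAt.comp_hasDerivAt ξ (hR.scomp ξ (hasDerivAt_neg ξ))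
      refine HasDerivAt.congr_deriv h3 ?_
      simp only [map_smul, ExtState.reflectL_apply]
      module
    · have h3 := (ExtState.reflectL.hasFDerivAt.comp_hasDerivAt ξ
        (hF.scomp ξ (hasDerivAt_neg ξ))).neg
      simp only [ExtState.flux_reflect]
      refine HasDerivAt.congr_deriv h3 ?_
      simp only [map_smul, ExtState.reflectL_apply]
      module

theorem AcousticWave.Connects.exists_reflect {b : ℝ} {w w' : ExtState} {W : AcousticWave}
    (h : W.Connects b .left w w') :
    ∃ W' : AcousticWave, W'.Connects b .right w'.reflect w.reflect := by
  cases W with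
  | absent => exact ⟨.absent, congrArg ExtState.reflect (Eq.symm h)⟩
  | shock s => exact ⟨.shock (-s), IsShock.reflect_left h⟩
  | rarefaction s s' R =>
    exact ⟨.rarefaction (-s') (-s) fun ξ => (R (-ξ)).reflect, IsRarefaction.reflect_left h⟩

/-! ### Shock waves and the wave curves -/

/-- The extended state with the given adiabatic exponent, density, velocity and pressure. -/
noncomputable def primitiveState (b γ ρ v p : ℝ) : ExtState :=
  (ρ, v * ρ, p * (1 - b * ρ) / (γ - 1) + ρ * v ^ 2 / 2, γ * ρ)

section PrimitiveState

variable {b γ ρ v p : ℝ}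

theorem primitiveState_vel (hρ : 0 < ρ) : (primitiveState b γ ρ v p).vel = v := by
  rw [ExtState.vel, primitiveState]; field_simp

theorem primitiveState_gam (hρ : 0 < ρ) : (primitiveState b γ ρ v p).gam = γ :=
  mul_div_cancel_right₀ γ hρ.ne'

theorem primitiveState_intEnergy :
    (primitiveState b γ ρ v p).intEnergy = p * (1 - b * ρ) / (γ - 1) := by
  simp only [ExtState.intEnergy, primitiveState]; field_simp; ring

theorem primitiveState_pcov (hρ : 0 < ρ) (hγ : 1 < γ) (hc : 0 < 1 - b * ρ) :
    (primitiveState b γ ρ v p).pcov b = p := by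
  have : 0 < γ - 1 := sub_pos.2 hγ
  rw [ExtState.pcov, primitiveState_gam hρ, primitiveState_intEnergy]
  change (γ - 1) / (1 - b * ρ) * (p * (1 - b * ρ) / (γ - 1)) = p
  generalize 1 - b * ρ = t at *
  field_simp

theorem primitiveState_mem (hρ : 0 < ρ) (hγ : 1 < γ) (hc : 0 < 1 - b * ρ) (hp : 0 < p) :
    primitiveState b γ ρ v p ∈ ExtState.admissible b := by
  have : 0 < γ - 1 := sub_pos.2 hγ
  refine ⟨hρ, hc, ?_, ?_⟩
  · rw [primitiveState_intEnergy]; positivity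
  · rw [primitiveState_gam hρ]; exact hγ.le

end PrimitiveState

/-- A state is joined by a left shock to a state of any higher pressure `P`; the square root in
the velocity jump is the mass flux through the shock. -/
theorem exists_isShock {b : ℝ} {w : ExtState} (hb : 0 ≤ b) (hw : w ∈ ExtState.admissible b)
    (hγ : 1 < w.gam) {P : ℝ} (hP : w.pcov b < P) :
    ∃ w₁ ∈ ExtState.admissible b, w₁.pcov b = P ∧
      w₁.vel = w.vel - (P - w.pcov b) /
        √(((w.gam + 1) * P + (w.gam - 1) * w.pcov b) / (2 * ((1 - b * w.1) / w.1))) ∧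
      ∃ s, IsShock b .left w w₁ s := by
  have ha := ExtState.soundSpeed_sq hw
  have ha0 := ExtState.soundSpeed_nonneg b w
  have hp0 := ExtState.pcov_nonneg hw
  have hpm := ExtState.pcov_mul hw.2.1
  have hw0 := hw
  obtain ⟨hρ, hc, he, -⟩ := hw
  set p := w.pcov b with hpd
  set γ := w.gam with hγd
  set τ := (1 - b * w.1) / w.1 with hτ
  have hτ0 : 0 < τ := by positivity
  have hγ1 : 0 < γ - 1 := by linarith
  have hP0 : 0 < P := by linarith
  have hM : 0 < (γ + 1) * P + (γ - 1) * p := by positivity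
  have hM' : 0 < (γ - 1) * P + (γ + 1) * p := by positivity
  set j := √(((γ + 1) * P + (γ - 1) * p) / (2 * τ)) with hj
  have hj0 : 0 < j := Real.sqrt_pos.2 (by positivity)
  have hj2 : j ^ 2 * (2 * τ) = (γ + 1) * P + (γ - 1) * p := by
    rw [hj, Real.sq_sqrt (by positivity)]; field_simp
  set τ₁ := τ * ((γ - 1) * P + (γ + 1) * p) / ((γ + 1) * P + (γ - 1) * p) with hτ₁
  have hτ₁0 : 0 < τ₁ := by positivity
  have hτM : τ₁ * ((γ + 1) * P + (γ - 1) * p) = τ * ((γ - 1) * P + (γ + 1) * p) := by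
    rw [hτ₁]; field_simp
  have hjτ : j ^ 2 * (2 * τ₁) = (γ - 1) * P + (γ + 1) * p := by
    have : τ * (j ^ 2 * (2 * τ₁)) = τ * ((γ - 1) * P + (γ + 1) * p) := by
      rw [← hτM, ← hj2]; ring
    exact mul_left_cancel₀ hτ0.ne' this
  have hlax : 0 < (γ + 1) * (P - p) := mul_pos (by linarith) (by linarith)
  have hjd : j ^ 2 * (τ - τ₁) = P - p := by linear_combination (hj2 - hjτ) / 2
  have hug : P * τ₁ - p * τ = (γ - 1) * ((p + P) / 2 * (τ - τ₁)) := by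
    linear_combination hτM / 2
  have hd : (P - p) / j = j * (τ - τ₁) := by
    rw [← hjd]; field_simp
  rw [hd]
  set ρ₁ := 1 / (τ₁ + b) with hρ₁
  have hρ₁0 : 0 < ρ₁ := by positivity
  have hc₁ : 1 - b * ρ₁ = τ₁ * ρ₁ := by rw [hρ₁]; field_simp; ring
  have hc₁0 : 0 < 1 - b * ρ₁ := by rw [hc₁]; positivity
  have hc₀ : 1 - b * w.1 = τ * w.1 := by rw [hτ]; field_simp
  have hi₀ : j / w.1 = j * (τ + b) := by
    have : w.1 * (τ + b) = 1 := by linear_combination -hc₀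
    rw [div_eq_iff hρ.ne']; linear_combination -j * this
  set v₁ := w.vel - j * (τ - τ₁) with hv₁
  set w₁ := primitiveState b γ ρ₁ v₁ P with hw₁
  have hm : w₁ ∈ ExtState.admissible b := primitiveState_mem hρ₁0 hγ hc₁0 hP0
  have hpc : w₁.pcov b = P := primitiveState_pcov hρ₁0 hγ hc₁0
  have hvc : w₁.vel = v₁ := primitiveState_vel hρ₁0
  have hgc : w₁.gam = γ := primitiveState_gam hρ₁0
  have hec : w₁.intEnergy = P * (1 - b * ρ₁) / (γ - 1) := primitiveState_intEnergy
  have hrc : w₁.1 = ρ₁ := rfl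
  have ha₁ := ExtState.soundSpeed_sq hm
  have ha₁0 := ExtState.soundSpeed_nonneg b w₁
  rw [hrc, hgc, hpc, hc₁] at ha₁
  rw [hc₀] at ha
  have hi₁ : v₁ - (w.vel - j / w.1) = j / ρ₁ := by
    rw [hv₁, hi₀, hρ₁]; field_simp; ring
  have hee : w.intEnergy = p * (τ * w.1) / (γ - 1) := by
    rw [eq_div_iff hγ1.ne', ← hc₀]; linarith
  refine ⟨w₁, hm, hpc, hvc, w.vel - j / w.1, hw0, hm, ?_, ?_, ?_, ?_⟩
  · rw [rankineHugoniot_iff hρ (by exact hρ₁0), ExtState.energy_eq hρ,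
      ExtState.energy_eq (w := w₁) hρ₁0, hrc, hvc, hpc, hgc, hi₁, hec, hee, hc₁,
      sub_sub_cancel]
    have e1 : w.1 * (j / w.1) = j := by field_simp
    have e2 : ρ₁ * (j / ρ₁) = j := by field_simp
    refine ⟨by rw [e1, e2], ?_, ?_, by simp [hγd]⟩
    · rw [e1, hv₁]; linear_combination -hjd
    · have e3 : (P * (τ₁ * ρ₁) / (γ - 1) + ρ₁ * v₁ ^ 2 / 2) * (j / ρ₁) -
          (p * (τ * w.1) / (γ - 1) + w.1 * w.vel ^ 2 / 2) * (j / w.1) =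
          j * ((P * τ₁ - p * τ) / (γ - 1) + (v₁ ^ 2 - w.vel ^ 2) / 2) := by
        field_simp
        ring
      rw [e3, hug, mul_div_cancel_left₀ _ hγ1.ne', hv₁]
      linear_combination (-w.vel + j * (τ - τ₁) / 2) * hjd
  · simp only [Family.speed]
    have : w.soundSpeed b < j / w.1 := by
      refine lt_of_pow_lt_pow_left₀ 2 (by positivity) ?_
      rw [div_pow, lt_div_iff₀ (by positivity)]
      refine lt_of_mul_lt_mul_right ?_ hτ0.le
      have : w.soundSpeed b ^ 2 * w.1 ^ 2 * τ = γ * p := by linear_combination ha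
      rw [this]
      linarith
    linarith
  · simp only [Family.speed]
    rw [hvc]
    have : j / ρ₁ < w₁.soundSpeed b := by
      refine lt_of_pow_lt_pow_left₀ 2 ha₁0 ?_
      rw [div_pow, div_lt_iff₀ (by positivity)]
      refine lt_of_mul_lt_mul_right ?_ hτ₁0.le
      have : w₁.soundSpeed b ^ 2 * ρ₁ ^ 2 * τ₁ = γ * P := by linear_combination ha₁
      rw [this]
      linarith
    linarith
  · rw [hvc]
    have : 0 < j / ρ₁ := by positivity
    linarith

/-- A state with `γ > 1` lies on its left rarefaction curve. -/
theorem eq_rarefactionState {b : ℝ} {w : ExtState} (hw : w ∈ ExtState.admissible b)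
    (hγ : 1 < w.gam) {q σ c : ℝ} (hq : q = 2 / (w.gam - 1)) (hσ : σ = w.1 / (1 - b * w.1))
    (hc : c ^ 2 * σ = w.gam * w.pcov b) :
    rarefactionState b q (w.vel + q * c) σ c = w := by
  have hpm := ExtState.pcov_mul hw.2.1
  obtain ⟨hρ, hcv, he, -⟩ := hw
  have hγ1 : 0 < w.gam - 1 := by linarith
  have hγ0 : 0 < w.gam := by linarith
  have e1 : σ / (1 + b * σ) = w.1 := by
    rw [hσ]
    have : 1 + b * (w.1 / (1 - b * w.1)) = 1 / (1 - b * w.1) := by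
      generalize hx : 1 - b * w.1 = t at *
      field_simp
      linarith
    rw [this, div_div_div_cancel_right₀ hcv.ne', div_one]
  have hq2 : q + 2 = 2 * w.gam / (w.gam - 1) := by rw [hq]; field_simp; ring
  rw [rarefactionState, e1]
  refine Prod.ext rfl (Prod.ext ?_ (Prod.ext ?_ ?_)) <;> simp only
  · rw [ExtState.vel_mul_fst hρ]; ring
  · rw [ExtState.energy_eq hρ, hq2]
    have : w.1 * (q ^ 2 * c ^ 2 / (2 * (2 * w.gam / (w.gam - 1)))) = w.intEnergy := by
      have hc2 : c ^ 2 = w.gam * (w.pcov b * (1 - b * w.1)) / w.1 := by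
        rw [hσ, mul_div_assoc', div_eq_iff hcv.ne'] at hc
        rw [eq_div_iff hρ.ne']
        linarith
      rw [hc2, hpm, hq]
      field_simp
    linear_combination this
  · rw [ExtState.gam_mul_fst hρ, hq]
    field_simp
    ring

/-- The left wave curve: for every pressure `P > 0` a left wave joins `w` to a state of pressure
`P` and velocity `w.vel - f P`, and `w.vel - f 0` is the speed of the edge of the vacuum. -/
theorem exists_left_wave_curve {b : ℝ} {w : ExtState} (hb : 0 ≤ b)
    (hw : w ∈ ExtState.admissible b) (hγ : 1 < w.gam) :
    ∃ f : ℝ → ℝ, Continuous f ∧ Filter.Tendsto f Filter.atTop Filter.atTop ∧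
      (∀ P, 0 < P → ∃ w₁ ∈ ExtState.admissible b, w₁.vel = w.vel - f P ∧ w₁.pcov b = P ∧
        ∃ W : AcousticWave, W.Connects b .left w w₁) ∧
      ∃ s R, IsRarefaction b .left w 0 s (w.vel - f 0) R := by
  have hpm := ExtState.pcov_mul hw.2.1
  have hγ1 : 0 < w.gam - 1 := by linarith
  have hρ := hw.1
  have hcv := hw.2.1
  have hp0 : 0 < w.pcov b :=
    pos_of_mul_pos_left (by rw [hpm]; exact mul_pos hγ1 hw.2.2.1) hcv.le
  set p := w.pcov b with hp
  set γ := w.gam with hγd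
  set τ := (1 - b * w.1) / w.1 with hτ
  have hτ0 : 0 < τ := by positivity
  set q := 2 / (γ - 1) with hq
  have hq0 : 0 < q := by positivity
  set σ := w.1 / (1 - b * w.1) with hσ
  have hσ0 : 0 < σ := by positivity
  set c := √(γ * p / σ) with hc
  have hc0 : 0 < c := Real.sqrt_pos.2 (by positivity)
  have hcσ : c ^ 2 * σ = γ * p := by
    rw [hc, Real.sq_sqrt (by positivity)]; field_simp
  set A := w.vel + q * c with hA
  have hwr : rarefactionState b q A σ c = w := eq_rarefactionState hw hγ hq hσ hcσ
  set r := 1 / (q + 2) with hr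
  have hr0 : 0 < r := by positivity
  -- one of the two summands vanishes: the first is the velocity drop of a rarefaction to a pressure
  -- `P ≤ p`, the second that of a shock to a pressure `P ≥ p`
  let f : ℝ → ℝ := fun P => q * c * ((min P p / p) ^ r - 1) +
    (max P p - p) / √(((γ + 1) * max P p + (γ - 1) * p) / (2 * τ))
  have hden : ∀ P, √(((γ + 1) * max P p + (γ - 1) * p) / (2 * τ)) ≠ 0 := by
    intro P
    have : 0 < max P p := hp0.trans_le (le_max_right _ _)
    exact (Real.sqrt_pos.2 (by positivity)).ne'
  have f_ge : ∀ P, p ≤ P →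
      f P = (P - p) / √(((γ + 1) * P + (γ - 1) * p) / (2 * τ)) := by
    intro P hP
    simp only [f, min_eq_right hP, max_eq_left hP, div_self hp0.ne', Real.one_rpow, sub_self,
      mul_zero, zero_add]
  have f_le : ∀ P, P ≤ p → f P = q * c * ((P / p) ^ r - 1) := by
    intro P hP
    simp only [f, min_eq_left hP, max_eq_right hP, sub_self, zero_div, add_zero]
  refine ⟨f, ?_, ?_, ?_, ?_⟩
  · have h1 : Continuous fun P : ℝ => (min P p / p) ^ r :=
      ((continuous_id.min continuous_const).div_const p).rpow_const fun _ => Or.inr hr0.le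
    simp only [f]
    fun_prop (disch := exact hden)
  · have hK : 0 < 2 * √(γ / τ) := by
      have : 0 < γ / τ := by positivity
      have := Real.sqrt_pos.2 this
      positivity
    -- a strong shock has a velocity jump of order `√P`
    refine Filter.tendsto_atTop_mono' _ ?_ (Real.tendsto_sqrt_atTop.atTop_div_const hK)
    filter_upwards [Filter.eventually_ge_atTop (2 * p)] with P hP
    have hP0 : 0 < P := by linarith
    rw [f_ge P (by linarith)]
    have h1 : √(((γ + 1) * P + (γ - 1) * p) / (2 * τ)) ≤ √(γ / τ) * √P := by
      rw [← Real.sqrt_mul (by positivity)]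
      refine Real.sqrt_le_sqrt ?_
      rw [div_mul_eq_mul_div, div_le_div_iff₀ (by positivity) hτ0]
      have : (γ + 1) * P + (γ - 1) * p ≤ 2 * (γ * P) := by nlinarith
      nlinarith
    have h2 : 0 < √(((γ + 1) * P + (γ - 1) * p) / (2 * τ)) :=
      Real.sqrt_pos.2 (by positivity)
    have h3 : √P * √P = P := Real.mul_self_sqrt hP0.le
    rw [div_le_div_iff₀ hK h2]
    calc √P * √(((γ + 1) * P + (γ - 1) * p) / (2 * τ)) ≤ √P * (√(γ / τ) * √P) := by gcongr
      _ = P * √(γ / τ) := by linear_combination √(γ / τ) * h3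
      _ ≤ (P - p) * (2 * √(γ / τ)) := by nlinarith
  · intro P hP
    rcases lt_trichotomy P p with h | h | h
    · have hx : 0 < P / p := by positivity
      have hx1 : P / p < 1 := (div_lt_one hp0).2 h
      have hxr : 0 < (P / p) ^ r := Real.rpow_pos_of_pos hx _
      have hxr1 : (P / p) ^ r < 1 := Real.rpow_lt_one hx.le hx1 hr0
      have hc₁ : 0 < c * (P / p) ^ r := by positivity
      have hc₁' : c * (P / p) ^ r < c := by nlinarith
      obtain ⟨R, hR⟩ := exists_isRarefaction A hb hq0 hσ0 hc₁.le hc₁'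
      have hσ₁ : 0 < σ * (c * (P / p) ^ r / c) ^ q := by positivity
      rw [hwr] at hR
      refine ⟨_, rarefactionState_mem hb hq0 hσ₁ hc₁, ?_, ?_, .rarefaction _ _ _, hR⟩
      · rw [rarefactionState_vel hb hσ₁, f_le P h.le, hA]; ring
      · rw [rarefactionState_pcov hb hq0 hσ₁, mul_div_cancel_left₀ _ hc0.ne']
        have h5 : ((P / p) ^ r) ^ 2 * ((P / p) ^ r) ^ q = P / p := by
          rw [← Real.rpow_natCast, ← Real.rpow_mul hx.le, ← Real.rpow_mul hx.le,
            ← Real.rpow_add hx]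
          have : r * (2 : ℕ) + r * q = 1 := by rw [hr]; push_cast; field_simp; ring
          rw [this, Real.rpow_one]
        have hqγ : q / (q + 2) = 1 / γ := by
          have hγ0 : 0 < γ := by linarith
          rw [hq]; field_simp; ring
        rw [hqγ]
        have e : (c * (P / p) ^ r) ^ 2 * (σ * ((P / p) ^ r) ^ q) =
            (c ^ 2 * σ) * (((P / p) ^ r) ^ 2 * ((P / p) ^ r) ^ q) := by ring
        rw [e, h5, hcσ]
        have hγ0 : 0 < γ := by linarith
        field_simp
    · refine ⟨w, hw, ?_, h.symm, .absent, rfl⟩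
      rw [f_ge P h.ge, h]; simp
    · obtain ⟨w₁, h1, h2, h3, s, h4⟩ := exists_isShock hb hw hγ h
      exact ⟨w₁, h1, by rw [h3, f_ge P h.le], h2, .shock s, h4⟩
  · obtain ⟨R, hR⟩ := exists_isRarefaction A hb hq0 hσ0 le_rfl hc0
    have h0 : rarefactionState b q A (σ * (0 / c) ^ q) 0 = 0 := by
      rw [zero_div, Real.zero_rpow hq0.ne', mul_zero, rarefactionState]
      simp
    have h1 : A - rarefactionCoord b q σ c 0 = w.vel - f 0 := by
      rw [f_le 0 hp0.le, zero_div, Real.zero_rpow hr0.ne', hA, rarefactionCoord]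
      simp
    rw [h0, h1, hwr] at hR
    exact ⟨_, R, hR⟩

/-- The Riemann problem with adiabatic exponents greater than one on both sides is solvable. -/
theorem exists_riemannFan_solves {b : ℝ} {wL wR : ExtState} (hb : 0 ≤ b)
    (hL : wL ∈ ExtState.admissible b) (hR : wR ∈ ExtState.admissible b)
    (hγL : 1 < wL.gam) (hγR : 1 < wR.gam) : ∃ F : RiemannFan, F.Solves b wL wR := by
  obtain ⟨f, hfc, hft, hf, s₁, R₁, hR₁⟩ := exists_left_wave_curve hb hL hγL
  obtain ⟨g, hgc, hgt, hg, s₃, R₃, hR₃⟩ := exists_left_wave_curve hb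
    (ExtState.reflect_mem_admissible.2 hR) (by simpa using hγR)
  rw [ExtState.reflect_vel] at hR₃
  by_cases hvac : 0 ≤ f 0 + g 0 + (wR.vel - wL.vel)
  · have h3 := hR₃.reflect_left
    rw [ExtState.reflect_reflect, show ExtState.reflect 0 = 0 by simp [ExtState.reflect]] at h3
    exact ⟨.vacuum _ _ R₁ _ _ _, hR₁, by linarith, h3⟩
  · push Not at hvac
    set G : ℝ → ℝ := fun P => f P + g P + (wR.vel - wL.vel) with hG
    have hGc : Continuous G := (hfc.add hgc).add continuous_const
    have hGt : Filter.Tendsto G Filter.atTop Filter.atTop :=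
      Filter.tendsto_atTop_add_const_right _ _ (hft.atTop_add_atTop hgt)
    obtain ⟨P₀, hP₀, hP₀'⟩ := ((hGt.eventually_ge_atTop 0).and
      (Filter.eventually_ge_atTop 0)).exists
    obtain ⟨P, hP, hGP⟩ := intermediate_value_Icc hP₀' hGc.continuousOn
      (Set.mem_Icc.2 ⟨hvac.le, hP₀⟩)
    have hPpos : 0 < P := by
      rcases hP.1.lt_or_eq with h | h
      · exact h
      · rw [← h] at hGP; exact absurd hGP hvac.ne
    obtain ⟨w₁, hw₁, hv₁, hp₁, W₁, hW₁⟩ := hf P hPpos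
    obtain ⟨w₂, hw₂, hv₂, hp₂, W₂, hW₂⟩ := hg P hPpos
    obtain ⟨W₃, hW₃⟩ := hW₂.exists_reflect
    rw [ExtState.reflect_reflect] at hW₃
    rw [ExtState.reflect_vel] at hv₂
    have hv : w₂.reflect.vel = w₁.vel := by
      rw [ExtState.reflect_vel, hv₁, hv₂]
      linarith
    refine ⟨.contact W₁ w₁ w₂.reflect w₁.vel W₃, hW₁,
      ⟨hw₁, ExtState.reflect_mem_admissible.2 hw₂, rfl, hv, ?_⟩, hW₃⟩
    rw [rankineHugoniot_iff hw₁.1 (show 0 < w₂.reflect.1 from hw₂.1), hv,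
      ExtState.reflect_pcov, hp₁, hp₂]
    simp

/-! ### From the Euler states to the Riemann data -/

section Datum

variable {d : ℕ} {b : ℝ} {p : State d → ℝ} {n : EuclideanSpace ℝ (Fin d)} {u : State d}

theorem Represents.intEnergy_eq {w : ExtState} (h : Represents n u w) (hn : ‖n‖ = 1)
    (hu : 0 < u.1) : w.intEnergy = u.1 * specificEnergy u := by
  obtain ⟨h1, h2, h3⟩ := h
  rw [mul_specificEnergy hu, ExtState.intEnergy, ← h1, ← h2, ← h3, normalEnergy,
    @norm_sub_sq_real, norm_smul, inner_smul_right, hn, mul_one, Real.norm_eq_abs, sq_abs]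
  ring

theorem represents_riemannDatum : Represents n u (riemannDatum b p n u) := ⟨rfl, rfl, rfl⟩

theorem riemannDatum_intEnergy (hn : ‖n‖ = 1) (hu : 0 < u.1) :
    (riemannDatum b p n u).intEnergy = u.1 * specificEnergy u :=
  represents_riemannDatum.intEnergy_eq hn hu

theorem riemannDatum_gam (hu : u ∈ admissible d b) : (riemannDatum b p n u).gam = gamma b p u := by
  have h1 := hu.1
  have h2 := hu.2.2
  simp only [ExtState.gam, riemannDatum, gamma]
  field_simp

theorem one_le_gamma (hu : u ∈ admissible d b) (hp : 0 ≤ p u) : 1 ≤ gamma b p u := by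
  have h1 := hu.1
  have h2 := hu.2.2
  have h3 := hu.2.1
  have : 0 ≤ p u * (1 - b * u.1) / (u.1 * specificEnergy u) := by positivity
  rw [gamma]
  linarith

theorem one_lt_gamma (hu : u ∈ admissible d b) (hp : 0 < p u) : 1 < gamma b p u := by
  have h1 := hu.1
  have h2 := hu.2.2
  have h3 := hu.2.1
  have : 0 < p u * (1 - b * u.1) / (u.1 * specificEnergy u) := by positivity
  rw [gamma]
  linarith

theorem riemannDatum_mem (hn : ‖n‖ = 1) (hu : u ∈ admissible d b) (hp : 0 ≤ p u) :
    riemannDatum b p n u ∈ ExtState.admissible b := by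
  refine ⟨hu.1, hu.2.1, ?_, ?_⟩
  · rw [riemannDatum_intEnergy hn hu.1]; exact mul_pos hu.1 hu.2.2
  · rw [riemannDatum_gam hu]; exact one_le_gamma hu hp

/-- The covolume pressure of the datum is the pressure given by the oracle. -/
theorem riemannDatum_pcov (hn : ‖n‖ = 1) (hu : u ∈ admissible d b) :
    (riemannDatum b p n u).pcov b = p u := by
  have h1 := hu.1
  have h2 := hu.2.2
  have h3 : 1 - b * u.1 ≠ 0 := hu.2.1.ne'
  rw [ExtState.pcov, riemannDatum_gam hu, riemannDatum_intEnergy hn hu.1, gamma,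
    add_sub_cancel_left]
  change p u * (1 - b * u.1) / (u.1 * specificEnergy u) / (1 - b * u.1) *
    (u.1 * specificEnergy u) = p u
  generalize 1 - b * u.1 = t at *
  field_simp

theorem riemannDatum_vel : (riemannDatum b p n u).vel = inner ℝ (velocity u) n := by
  rw [ExtState.vel, velocity, real_inner_smul_left, div_eq_inv_mul]
  rfl

/-- The energy of the one-dimensional datum in a frame omits the tangential kinetic energy. -/
theorem riemannDatum_frameEnergy_le (hn : ‖n‖ = 1) (hu : u ∈ admissible d b)
    (k : EuclideanSpace ℝ (Fin d)) :
    ExtState.frameEnergy (inner ℝ k n) (riemannDatum b p n u) ≤ frameEnergy k u := by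
  have h1 : 0 < u.1 := hu.1
  rw [ExtState.frameEnergy_eq _ (show 0 < (riemannDatum b p n u).1 from h1),
    frameEnergy_eq k h1, riemannDatum_intEnergy hn h1, mul_specificEnergy h1, riemannDatum_vel]
  have h2 : |inner ℝ (k - velocity u) n| ≤ ‖k - velocity u‖ := by
    have := abs_real_inner_le_norm (k - velocity u) n
    rwa [hn, mul_one] at this
  have h3 : (inner ℝ (velocity u) n - inner ℝ k n) ^ 2 ≤ ‖k - velocity u‖ ^ 2 := by
    rw [← inner_sub_left, ← neg_sub, inner_neg_left, neg_sq, ← sq_abs]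
    exact pow_le_pow_left₀ (abs_nonneg _) h2 2
  have h4 : u.1 / 2 * (inner ℝ (velocity u) n - inner ℝ k n) ^ 2 ≤
      u.1 / 2 * ‖k - velocity u‖ ^ 2 := mul_le_mul_of_nonneg_left h3 (by linarith)
  have h5 : (riemannDatum b p n u).1 = u.1 := rfl
  rw [h5]
  linarith

/-- The frame energy is advected, and changed by the work of the pressure. -/
theorem frameEnergy_flux (hu : 0 < u.1) (k : EuclideanSpace ℝ (Fin d)) :
    frameEnergy k (flux p u n) = inner ℝ (velocity u) n * frameEnergy k u +
      p u * (inner ℝ (velocity u) n - inner ℝ k n) := by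
  have : (inner ℝ u.2.1 n : ℝ) = u.1 * inner ℝ (velocity u) n := by
    rw [velocity, real_inner_smul_left]; field_simp
  simp only [frameEnergy, flux, inner_add_right, inner_smul_right, this]
  ring

end Datum

/-- `flux p u` as a linear map. -/
noncomputable def fluxL {d : ℕ} (p : State d → ℝ) (u : State d) :
    EuclideanSpace ℝ (Fin d) →ₗ[ℝ] State d where
  toFun := flux p u
  map_add' x y := by
    simp only [flux, inner_add_right, Prod.mk_add_mk, Prod.mk.injEq]
    exact ⟨trivial, by module, by ring⟩
  map_smul' r x := by
    simp only [flux, inner_smul_right, Prod.smul_mk, Prod.mk.injEq, RingHom.id_apply, smul_eq_mul]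
    exact ⟨trivial, by module, by ring⟩

theorem fluxL_apply {d : ℕ} (p : State d → ℝ) (u : State d) (c : EuclideanSpace ℝ (Fin d)) :
    fluxL p u c = flux p u c := rfl

/-- The average of the Riemann fan, lifted back to the Euler states, is admissible: the internal
energy is tested in the frame moving with the average velocity. -/
theorem average_mem_admissible {d : ℕ} {b : ℝ} {p : State d → ℝ}
    {n : EuclideanSpace ℝ (Fin d)} {uL uR : State d} {lam : ℝ} {F : RiemannFan} (hn : ‖n‖ = 1)
    (hL : uL ∈ admissible d b) (hR : uR ∈ admissible d b) (hpL : 0 ≤ p uL) (hpR : 0 ≤ p uR)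
    (hF : F.Solves b (riemannDatum b p n uL) (riemannDatum b p n uR)) (hlam : 0 < lam)
    (hs : ∀ s ∈ F.speeds, |s| ≤ lam) :
    (1 / 2 : ℝ) • (uL + uR) - (1 / (2 * lam)) • (flux p uR n - flux p uL n) ∈
      admissible d b := by
  have hwL := riemannDatum_mem hn hL hpL
  have hwR := riemannDatum_mem hn hR hpR
  set B := (1 / 2 : ℝ) • (uL + uR) - (1 / (2 * lam)) • (flux p uR n - flux p uL n) with hB
  have hB1 : 2 * lam * B.1 = lam * (uL.1 + uR.1) - (inner ℝ uR.2.1 n - inner ℝ uL.2.1 n) := by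
    simp only [hB, flux, Prod.fst_sub, Prod.smul_fst, Prod.fst_add, smul_eq_mul]
    field_simp
  have h1 := (hF.fanIntegral_pos (α := 0) (ℓ := ContinuousLinearMap.fst ℝ ℝ (ℝ × ℝ × ℝ)) hwL hwR
    hlam hs le_rfl (fun w hw => by simpa using hw.1)
    (Or.inl ⟨1, fun w => (one_mul w.1).symm⟩)).2.2
  have h2 := (hF.fanIntegral_pos (α := 1) (ℓ := (-b) • ContinuousLinearMap.fst ℝ ℝ (ℝ × ℝ × ℝ))
    hwL hwR hlam hs zero_le_one (fun w hw => by simpa [← sub_eq_add_neg] using hw.2.1)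
    (Or.inl ⟨-b, fun w => rfl⟩)).2.2
  have hBpos : 0 < B.1 := by
    have : 0 < 2 * lam * B.1 := by
      rw [hB1]
      simp only [fanIntegral, ExtState.relFlux, ExtState.flux, riemannDatum,
        ContinuousLinearMap.coe_fst', Prod.fst_sub, Prod.smul_fst, smul_eq_mul] at h1
      linarith
    exact pos_of_mul_pos_right this (by linarith)
  refine mem_admissible_iff.2 ⟨hBpos, ?_, ?_⟩
  · have : 0 < 2 * lam * (1 - b * B.1) := by
      have e : 2 * lam * (1 - b * B.1) = 2 * lam - b * (2 * lam * B.1) := by ring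
      rw [e, hB1]
      simp only [fanIntegral, ExtState.relFlux, ExtState.flux, riemannDatum,
        _root_.smul_apply,
        ContinuousLinearMap.coe_fst', Prod.fst_sub, Prod.smul_fst, smul_eq_mul] at h2
      linarith
    exact pos_of_mul_pos_right this (by linarith)
  · set k := velocity B with hk
    rw [← frameEnergy_velocity hBpos, ← hk]
    obtain ⟨hvL, hvR, h3⟩ := hF.fanIntegral_pos (α := 0)
      (ℓ := ExtState.frameEnergy (inner ℝ k n)) hwL hwR hlam hs le_rfl
      (fun w hw => by simpa using ExtState.frameEnergy_pos _ hw)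
      (ExtState.vacuumTest_frameEnergy b _)
    rw [riemannDatum_vel] at hvL hvR
    have key : 2 * lam * frameEnergy k B =
        (lam + inner ℝ (velocity uL) n) * frameEnergy k uL +
          p uL * (inner ℝ (velocity uL) n - inner ℝ k n) +
        ((lam - inner ℝ (velocity uR) n) * frameEnergy k uR -
          p uR * (inner ℝ (velocity uR) n - inner ℝ k n)) := by
      rw [hB, sub_eq_add_neg, ← neg_smul, sub_eq_add_neg, ← neg_one_smul ℝ (flux p uL n)]
      simp only [frameEnergy_add, frameEnergy_smul, frameEnergy_flux hL.1, frameEnergy_flux hR.1]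
      field_simp
      ring
    have h4 : ExtState.frameEnergy (inner ℝ k n) ((riemannDatum b p n uL).relFlux b (-lam)) =
        (lam + inner ℝ (velocity uL) n) *
          ExtState.frameEnergy (inner ℝ k n) (riemannDatum b p n uL) +
        p uL * (inner ℝ (velocity uL) n - inner ℝ k n) := by
      rw [ExtState.frameEnergy_relFlux _ hwL.1, ← ExtState.frameEnergy_eq _ hwL.1,
        riemannDatum_vel, riemannDatum_pcov hn hL]
      ring
    have h5 : ExtState.frameEnergy (inner ℝ k n) ((riemannDatum b p n uR).relFlux b lam) =
        -((lam - inner ℝ (velocity uR) n) *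
          ExtState.frameEnergy (inner ℝ k n) (riemannDatum b p n uR) -
        p uR * (inner ℝ (velocity uR) n - inner ℝ k n)) := by
      rw [ExtState.frameEnergy_relFlux _ hwR.1, ← ExtState.frameEnergy_eq _ hwR.1,
        riemannDatum_vel, riemannDatum_pcov hn hR]
      ring
    rw [fanIntegral, map_sub, h4, h5] at h3
    have h6 := mul_le_mul_of_nonneg_left (riemannDatum_frameEnergy_le (p := p) hn hL k)
      (show 0 ≤ lam + inner ℝ (velocity uL) n by linarith)
    have h7 := mul_le_mul_of_nonneg_left (riemannDatum_frameEnergy_le (p := p) hn hR k)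
      (show 0 ≤ lam - inner ℝ (velocity uR) n by linarith)
    have : 0 < 2 * lam * frameEnergy k B := by rw [key]; linarith
    exact pos_of_mul_pos_right this (by linarith)

/-! ### The auxiliary states and the low-order update -/

section Scheme

variable {V : Type*} {d : ℕ} {b : ℝ} {p : State d → ℝ} {c : V → V → EuclideanSpace ℝ (Fin d)}
  {dL : V → V → ℝ} {U : V → State d} {i j : V}

theorem norm_direction {c : EuclideanSpace ℝ (Fin d)} (hc : c ≠ 0) : ‖direction c‖ = 1 := by
  rw [direction, norm_smul, norm_inv, norm_norm, inv_mul_cancel₀ (norm_ne_zero_iff.2 hc)]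

theorem flux_direction (u : State d) {c : EuclideanSpace ℝ (Fin d)} (hc : c ≠ 0) :
    flux p u c = ‖c‖ • flux p u (direction c) := by
  rw [← fluxL_apply, ← fluxL_apply, ← map_smul, direction, smul_inv_smul₀ (norm_ne_zero_iff.2 hc)]

theorem flux_zero (u : State d) : flux p u 0 = 0 := by
  rw [← fluxL_apply, map_zero]

theorem barState_of_eq_zero (hc : c i j = 0) :
    barState p c dL U i j = (1 / 2 : ℝ) • (U i + U j) := by
  simp [barState, hc, flux_zero]

theorem barState_self (hc : c i i = 0) : barState p c dL U i i = U i := by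
  rw [barState_of_eq_zero hc]
  module

theorem barState_eq_direction (hc : c i j ≠ 0) :
    barState p c dL U i j = (1 / 2 : ℝ) • (U i + U j) - (1 / (2 * (dL i j / ‖c i j‖))) •
      (flux p (U j) (direction (c i j)) - flux p (U i) (direction (c i j))) := by
  rw [barState, flux_direction _ hc, flux_direction _ hc, ← smul_sub, smul_smul]
  congr 2
  rw [mul_div_assoc', one_div_div, div_mul_eq_mul_div, one_mul]

/-- If a pressure vanishes, a solution of the Riemann problem is a hypothesis; otherwise it is
constructed. -/
theorem barState_mem_admissible {lam : ℝ} (hb : 0 ≤ b) (hp : ∀ u ∈ admissible d b, 0 ≤ p u)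
    (hUi : U i ∈ admissible d b) (hUj : U j ∈ admissible d b)
    (hlam : c i j ≠ 0 → IsWaveSpeedBound b (riemannDatum b p (direction (c i j)) (U i))
      (riemannDatum b p (direction (c i j)) (U j)) lam)
    (hd : lam * ‖c i j‖ ≤ dL i j)
    (hsolv : c i j ≠ 0 → p (U i) = 0 ∨ p (U j) = 0 →
      ∃ F : RiemannFan, F.Solves b (riemannDatum b p (direction (c i j)) (U i))
        (riemannDatum b p (direction (c i j)) (U j))) :
    barState p c dL U i j ∈ admissible d b := by
  by_cases hc : c i j = 0
  · rw [barState_of_eq_zero hc, smul_add]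
    exact convex_admissible d b hUi hUj (by norm_num) (by norm_num) (by norm_num)
  have hn := norm_direction hc
  have hpi := hp _ hUi
  have hpj := hp _ hUj
  obtain ⟨F, hF⟩ : ∃ F : RiemannFan, F.Solves b (riemannDatum b p (direction (c i j)) (U i))
      (riemannDatum b p (direction (c i j)) (U j)) := by
    by_cases h0 : p (U i) = 0 ∨ p (U j) = 0
    · exact hsolv hc h0
    · push Not at h0
      refine exists_riemannFan_solves hb (riemannDatum_mem hn hUi hpi)
        (riemannDatum_mem hn hUj hpj) ?_ ?_
      · rw [riemannDatum_gam hUi]; exact one_lt_gamma hUi (hpi.lt_of_ne' h0.1)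
      · rw [riemannDatum_gam hUj]; exact one_lt_gamma hUj (hpj.lt_of_ne' h0.2)
  obtain ⟨hlam0, hsp⟩ := hlam hc
  have hle : lam ≤ dL i j / ‖c i j‖ := (le_div_iff₀ (norm_pos_iff.2 hc)).2 hd
  rw [barState_eq_direction hc]
  exact average_mem_admissible hn hUi hUj hpi hpj hF (hlam0.trans_le hle)
    fun s hs => (hsp F hF s hs).trans hle

/-- The surrogate functional compares the internal energy with that of a gas of entropy
`entropyMin`. -/
theorem surrogate_eq (s : Finset V) (hs : s.Nonempty) (u : State d) :
    surrogate b p c dL U i s hs u = u.1 * specificEnergy u -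
      entropyMin b p c dL U i s hs * isentropicEnergy b (gammaMin b p U s hs) u.1 := by
  rw [surrogate, isentropicEnergy, mul_assoc]

theorem surrogate_nonneg {s : Finset V} {hs : s.Nonempty} {u : State d}
    (hu : u ∈ admissible d b)
    (h : entropyMin b p c dL U i s hs ≤ entropyS b u (gammaMin b p U s hs)) :
    0 ≤ surrogate b p c dL U i s hs u := by
  rw [surrogate_eq, ← entropyS_mul_isentropicEnergy hu (gammaMin b p U s hs), ← sub_mul]
  exact mul_nonneg (sub_nonneg.2 h) (isentropicEnergy_pos hu.1 hu.2.1).le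

/-- The surrogate functional increases from a state `u` of the stencil to a compressed state of
larger entropy. -/
theorem surrogate_lt_surrogate {s : Finset V} {hs : s.Nonempty} {n : EuclideanSpace ℝ (Fin d)}
    {ua ub : State d} {wb : ExtState} (hb : 0 ≤ b) (hn : ‖n‖ = 1) (hj : j ∈ s)
    (hU : U j ∈ admissible d b) (hγ : 1 ≤ gammaMin b p U s hs)
    (hwb : wb ∈ ExtState.admissible b)
    (hρ : (U j).1 < wb.1)
    (hS : (riemannDatum b p n (U j)).intEnergy * isentropicEnergy b (gammaMin b p U s hs) wb.1 <
      wb.intEnergy * isentropicEnergy b (gammaMin b p U s hs) (U j).1)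
    (ha : Represents n ua (riemannDatum b p n (U j))) (hub : Represents n ub wb) :
    surrogate b p c dL U i s hs ua < surrogate b p c dL U i s hs ub := by
  have hua : ua.1 = (U j).1 := ha.1
  have hub1 : ub.1 = wb.1 := hub.1
  have hUj : 0 < (U j).1 := hU.1
  rw [surrogate_eq, surrogate_eq, ← ha.intEnergy_eq hn (by rw [hua]; exact hU.1),
    ← hub.intEnergy_eq hn (by rw [hub1]; exact hwb.1), hua, hub1]
  have h1 : entropyMin b p c dL U i s hs ≤ entropyS b (U j) (gammaMin b p U s hs) :=
    (min_le_left _ _).trans (Finset.inf'_le _ hj)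
  have h2 := entropyS_mul_isentropicEnergy hU (gammaMin b p U s hs)
  rw [← riemannDatum_intEnergy (b := b) (p := p) hn hU.1] at h2
  have h3 := isentropicEnergy_le hb hγ hU.1 hρ.le hwb.2.1
  have h4 := isentropicEnergy_pos (γ := gammaMin b p U s hs) hU.1 hU.2.1
  set γ := gammaMin b p U s hs
  set S := entropyS b (U j) γ
  set S₀ := entropyMin b p c dL U i s hs
  have h5 : S * isentropicEnergy b γ wb.1 < wb.intEnergy := by
    rw [← h2] at hS
    refine lt_of_mul_lt_mul_right ?_ h4.le
    linarith
  have h6 := mul_le_mul_of_nonneg_right h1 (sub_nonneg.2 h3)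
  linarith

/-- The low-order update is a convex combination of the auxiliary states; that with `j = i` is
`U i`. -/
theorem IsLowOrderUpdate.eq_sum [DecidableEq V] {I : V → Finset V} {m : V → ℝ} {τ : ℝ}
    {Uplus : State d} (h : IsLowOrderUpdate p c dL I m U i τ Uplus) (hi : i ∈ I i) (hm : 0 < m i)
    (hτ : 0 < τ) (hcii : c i i = 0) (hc : ∑ j ∈ I i, c i j = 0)
    (hd : ∀ j, c i j = 0 → dL i j = 0) (hd' : ∀ j ∈ I i, c i j ≠ 0 → 0 < dL i j) :
    Uplus = ∑ j ∈ I i, (if j = i then 1 - τ * ∑ l ∈ (I i).erase i, 2 * dL i l / m i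
      else τ * (2 * dL i j / m i)) • barState p c dL U i j := by
  have hsum : ∑ j ∈ (I i).erase i, (dL i j • (U j - U i) -
      (flux p (U j) (c i j) - flux p (U i) (c i j))) = (m i / τ) • (Uplus - U i) := by
    have h1 : ∑ j ∈ (I i).erase i, flux p (U j) (c i j) = ∑ j ∈ I i, flux p (U j) (c i j) := by
      rw [← Finset.add_sum_erase _ _ hi, hcii, flux_zero, zero_add]
    have h2 : ∑ j ∈ (I i).erase i, flux p (U i) (c i j) = 0 := by
      have : ∑ j ∈ I i, flux p (U i) (c i j) = 0 := by
        simp only [← fluxL_apply]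
        rw [← map_sum, hc, map_zero]
      rwa [← Finset.add_sum_erase _ _ hi, hcii, flux_zero, zero_add] at this
    rw [Finset.sum_sub_distrib, Finset.sum_sub_distrib, h1, h2, sub_zero]
    rw [IsLowOrderUpdate] at h
    rw [eq_comm, ← sub_eq_zero, ← h]
    abel
  have hbar : ∀ j ∈ (I i).erase i, dL i j • (U j - U i) -
      (flux p (U j) (c i j) - flux p (U i) (c i j)) =
      (2 * dL i j) • (barState p c dL U i j - U i) := by
    intro j hj
    by_cases hcj : c i j = 0
    · simp [hcj, hd j hcj, flux_zero]
    · have := hd' j (Finset.mem_of_mem_erase hj) hcj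
      have e : (2 * dL i j) * (1 / (2 * dL i j)) = 1 := by field_simp
      rw [barState, smul_sub, smul_sub (2 * dL i j), smul_sub (2 * dL i j),
        smul_smul _ (1 / (2 * dL i j)), e]
      module
  rw [Finset.sum_congr rfl hbar] at hsum
  have hU : Uplus - U i =
      ∑ j ∈ (I i).erase i, (τ * (2 * dL i j / m i)) • (barState p c dL U i j - U i) := by
    have h3 : Uplus - U i = (τ / m i) • (m i / τ) • (Uplus - U i) := by
      rw [smul_smul, div_mul_div_cancel₀ hm.ne', div_self hτ.ne', one_smul]
    rw [h3, ← hsum, Finset.smul_sum]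
    refine Finset.sum_congr rfl fun j _ => ?_
    rw [smul_smul]
    congr 1
    ring
  have hrest : ∑ j ∈ (I i).erase i, (if j = i then 1 - τ * ∑ l ∈ (I i).erase i, 2 * dL i l / m i
      else τ * (2 * dL i j / m i)) • barState p c dL U i j =
      ∑ j ∈ (I i).erase i, (τ * (2 * dL i j / m i)) • barState p c dL U i j :=
    Finset.sum_congr rfl fun j hj => by rw [if_neg (Finset.ne_of_mem_erase hj)]
  rw [← Finset.add_sum_erase _ _ hi, if_pos rfl, barState_self hcii, hrest]
  simp only [smul_sub, Finset.sum_sub_distrib, ← Finset.sum_smul, ← Finset.mul_sum] at hU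
  rw [eq_add_of_sub_eq hU]
  module

end Scheme

end CovolumeEuler

theorem theorem4p2 {V : Type*} [DecidableEq V] {d : ℕ}
    -- the covolume constant and the nonnegative pressure oracle
    (b : ℝ) (hb : 0 ≤ b) (p : State d → ℝ) (hp : ∀ u ∈ admissible d b, 0 ≤ p u)
    -- stencils, lumped masses, coefficients `c_ij`
    (I : V → Finset V) (hI : ∀ k, k ∈ I k) (m : V → ℝ) (hm : ∀ k, 0 < m k)
    (c : V → V → EuclideanSpace ℝ (Fin d))
    (hc_stencil : ∀ k l, l ∉ I k → c k l = 0)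
    (hc_skew : ∀ k l, c k l = -c l k)
    (hc_sum : ∀ k, ∑ l ∈ I k, c k l = 0)
    -- the node `i`, and the current states on its stencil
    (U : V → State d) (i : V) (hU : ∀ j ∈ I i, U j ∈ admissible d b)
    -- positive upper bounds of the maximum wave speeds, which define the graph viscosity
    (lam : V → V → ℝ)
    (hlam : ∀ j ∈ I i, c i j ≠ 0 →
      IsWaveSpeedBound b (riemannDatum b p (direction (c i j)) (U i))
        (riemannDatum b p (direction (c i j)) (U j)) (lam i j) ∧
      IsWaveSpeedBound b (riemannDatum b p (direction (c j i)) (U j))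
        (riemannDatum b p (direction (c j i)) (U i)) (lam j i))
    -- solvability is only required where a pressure vanishes
    (hsolv : ∀ j ∈ I i, c i j ≠ 0 → p (U i) = 0 ∨ p (U j) = 0 →
      ∃ F : RiemannFan, F.Solves b (riemannDatum b p (direction (c i j)) (U i))
        (riemannDatum b p (direction (c i j)) (U j))) :
    -- the auxiliary states are admissible, so that `Ψ_i` is well defined
    (∀ j ∈ I i, barState p c (graphViscosity c lam) U i j ∈ admissible d b) ∧
    -- (i)
    ConcaveOn ℝ (admissible d b)
      (surrogate b p c (graphViscosity c lam) U i (I i) ⟨i, hI i⟩) ∧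
    -- (ii)
    (∀ (τ : ℝ) (Uplus : State d), 0 < τ →
      IsLowOrderUpdate p c (graphViscosity c lam) I m U i τ Uplus →
      τ * ∑ j ∈ (I i).erase i, 2 * graphViscosity c lam i j / m i ≤ 1 →
      Uplus ∈ admissible d b ∧
        0 ≤ surrogate b p c (graphViscosity c lam) U i (I i) ⟨i, hI i⟩ Uplus) ∧
    -- (iii)
    (∀ j ∈ I i, c i j ≠ 0 → ∀ F : RiemannFan,
      F.Solves b (riemannDatum b p (direction (c i j)) (U i))
        (riemannDatum b p (direction (c i j)) (U j)) →
      ∀ wa wb : ExtState,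
        F.HasShock (riemannDatum b p (direction (c i j)) (U i))
          (riemannDatum b p (direction (c i j)) (U j)) wa wb →
        ∀ ua ub : State d, Represents (direction (c i j)) ua wa →
          Represents (direction (c i j)) ub wb →
          surrogate b p c (graphViscosity c lam) U i (I i) ⟨i, hI i⟩ ua <
            surrogate b p c (graphViscosity c lam) U i (I i) ⟨i, hI i⟩ ub) := by
  set dL := graphViscosity c lam with hdL
  have hcii : c i i = 0 := by
    have h : (2 : ℝ) • c i i = 0 := by
      rw [two_smul]
      nth_rewrite 1 [hc_skew i i]
      exact neg_add_cancel _
    exact (smul_eq_zero.1 h).resolve_left two_ne_zero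
  have hnorm : ∀ j, ‖c j i‖ = ‖c i j‖ := fun j => by rw [hc_skew j i, norm_neg]
  have hd : ∀ j, c i j = 0 → dL i j = 0 := fun j hj => by
    simp [hdL, graphViscosity, hnorm, hj]
  have hd' : ∀ j ∈ I i, c i j ≠ 0 → 0 < dL i j := fun j hj hcj =>
    (mul_pos (hlam j hj hcj).1.1 (norm_pos_iff.2 hcj)).trans_le (le_max_left _ _)
  have hbar : ∀ j ∈ I i, barState p c dL U i j ∈ admissible d b := fun j hj =>
    barState_mem_admissible hb hp (hU i (hI i)) (hU j hj) (fun hcj => (hlam j hj hcj).1)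
      (le_max_left _ _) (hsolv j hj)
  have hγ : 1 ≤ gammaMin b p U (I i) ⟨i, hI i⟩ :=
    Finset.le_inf' _ _ fun j hj => one_le_gamma (hU j hj) (hp _ (hU j hj))
  have hS : 0 ≤ entropyMin b p c dL U i (I i) ⟨i, hI i⟩ :=
    le_min (Finset.le_inf' _ _ fun j hj => (entropyS_pos (hU j hj) _).le)
      (Finset.le_inf' _ _ fun j hj => (entropyS_pos (hbar j hj) _).le)
  have hconc : ConcaveOn ℝ (admissible d b) (surrogate b p c dL U i (I i) ⟨i, hI i⟩) :=
    (concaveOn_mul_specificEnergy_sub hγ hS).congr fun u _ => (surrogate_eq _ _ u).symm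
  refine ⟨hbar, hconc, ?_, ?_⟩
  · intro τ Uplus hτ hup hcfl
    have hsum : ∑ j ∈ I i, (if j = i then 1 - τ * ∑ l ∈ (I i).erase i, 2 * dL i l / m i
        else τ * (2 * dL i j / m i)) = 1 := by
      rw [← Finset.add_sum_erase _ _ (hI i), if_pos rfl,
        Finset.sum_congr rfl fun j hj => if_neg (Finset.ne_of_mem_erase hj), ← Finset.mul_sum]
      ring
    rw [hup.eq_sum (hI i) (hm i) hτ hcii (hc_sum i) hd hd']
    refine (hconc.convex_ge 0).sum_mem (fun j hj => ?_) hsum fun j hj => ?_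
    · split_ifs
      · linarith
      · have : 0 ≤ dL i j := by
          by_cases hcj : c i j = 0
          · exact (hd j hcj).ge
          · exact (hd' j hj hcj).le
        have := hm i
        positivity
    · exact ⟨hbar j hj, surrogate_nonneg (hbar j hj)
        ((min_le_right _ _).trans (Finset.inf'_le _ hj))⟩
  · intro j hj hcj F hF wa wb hshock ua ub hua hub
    have hn := norm_direction hcj
    have hle : ∀ k ∈ I i, gammaMin b p U (I i) ⟨i, hI i⟩ ≤
        (riemannDatum b p (direction (c i j)) (U k)).gam := fun k hk => by
      rw [riemannDatum_gam (hU k hk)]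
      exact Finset.inf'_le _ hk
    cases F with
    | vacuum => exact hshock.elim
    | contact W₁ w₁ w₂ v W₃ =>
      obtain ⟨h1, -, h3⟩ := hF
      rcases hshock with ⟨s, rfl, rfl, rfl⟩ | ⟨s, rfl, rfl, rfl⟩
      · have h : IsShock b .left _ wb s := h1
        exact surrogate_lt_surrogate hb hn (hI i) (hU i (hI i)) hγ h.2.1 h.compressive.2.2.1
          (h.intEnergy_mul_lt (hle i (hI i))) hua hub
      · have h : IsShock b .right wb _ s := h3
        have hr := h.reflect_right
        refine surrogate_lt_surrogate hb hn hj (hU j hj) hγ h.1 hr.compressive.2.2.1 ?_ hua hub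
        have hlt := hr.intEnergy_mul_lt (by simpa using hle j hj)
        simp only [ExtState.reflect_intEnergy, ExtState.reflect_fst] at hlt
        exact hlt
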